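/- Let $\alpha\in(0,1]$, let $P$ be a probability distribution on $\mathbb R^m$ and let $C:\mathbb R^n\times\mathbb R^m\to\mathbb R^n$ be measurable. For a real random variable $Z$ put $\operatorname{CVaR}_\alpha[Z]=\inf_{\eta\in\mathbb R}\{\eta+\alpha^{-1}\mathbb E[Z-\eta]^+\}$, where $[x]^+=\max(x,0)$. Suppose that, for $\xi\sim P$, the value $F_i(h)=\operatorname{CVaR}_\alpha[C_i(h,\xi)]$ is finite for all $h\in\mathbb R^n$ and $i=1,\dots,n$, and that the map $F=(F_1,\dots,F_n):\mathbb R^n\to\mathbb R^n$ is continuous and strictly monotone, i.e. $(F(x)-F(y))^\top(x-y)>0$ for all $x\ne y$. Let $\mathcal H=\{h\in\mathbb R^n: Ah=b,\ q^i(h)\le 0,\ i=1,\dots,s\}$ be nonempty and compact, where $A\in\mathbb R^{l\times n}$, $b\in\mathbb R^l$ and the functions $q^i:\mathbb R^n\to\mathbb R$ are convex and continuously differentiable. Then there is exactly one $h^*\in\mathcal H$ with $(h-h^*)^\top F(h^*)\ge 0$ for all $h\in\mathcal H$, and the following holds for all $B\in\mathbb R$ and $\epsilon>0$. There is $N_\epsilon\in\mathbb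 N$ (depending on $\alpha,P,C,\mathcal H,B,\epsilon$ only) such that for all step sizes $\gamma^k>0$ with $\sum_k\gamma^k=\infty$ and $\sum_k(\gamma^k)^2<\infty$, all $h^0\in\mathcal H$, all sequences $(N_k)_{k\ge0}$ in $\mathbb N$ with $N_k\ge N_\epsilon$ for all $k$, and all independent samples $\xi_{k,j}$ ($k\ge 0$, $1\le j\le N_k$) with law $P$, the iterates $$h^{k+1}=\Pi_{\mathcal H}\big(h^k-\gamma^k\widehat F^{N_k}(h^k)\big),\qquad \widehat F^{N_k}_i(h)=\inf_{t\in\mathbb R}\Big\{t+\frac1{N_k\alpha}\sum_{j=1}^{N_k}\big[C_i(h,\xi_{k,j})-t\big]^+\Big\},$$ where $\Pi_{\mathcal H}$ is the Euclidean projection onto $\mathcal H$, satisfy the following: if almost surely $\|\widehat F^{N_k}(h^k)-F(h^k)\|\le B$ for all $k$, then almost surely $$\limsup_{k\to\infty}\|h^k-h^*\|\le\epsilon.$$ -/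

import Mathlib

open MeasureTheory ProbabilityTheory Filter Topology

noncomputable section

namespace CVaRVI

/-- `ℝⁿ` with the Euclidean norm. -/
abbrev E (n : ℕ) : Type := EuclideanSpace ℝ (Fin n)

/-- The function `η ↦ η + α⁻¹ 𝔼[Z - η]⁺`. -/
def cvarObjective {S : Type*} [MeasurableSpace S] (α : ℝ) (P : Measure S) (Z : S → ℝ)
    (η : ℝ) : ℝ :=
  η + α⁻¹ * ∫ x, max (Z x - η) 0 ∂P

/-- `CVaR_α[Z] = inf_η {η + α⁻¹ 𝔼[Z - η]⁺}`. -/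
def cvar {S : Type*} [MeasurableSpace S] (α : ℝ) (P : Measure S) (Z : S → ℝ) : ℝ :=
  ⨅ η : ℝ, cvarObjective α P Z η

/-- The infimum defining `CVaR_α[Z]` is a real number: the expectations are finite and
the infimum is not `-∞`. -/
def HasFiniteCVaR {S : Type*} [MeasurableSpace S] (α : ℝ) (P : Measure S) (Z : S → ℝ) : Prop :=
  (∀ η : ℝ, Integrable (fun x => max (Z x - η) 0) P) ∧
    BddBelow (Set.range (cvarObjective α P Z))

/-- The empirical estimate `inf_η {η + (N α)⁻¹ ∑ⱼ [zⱼ - η]⁺}` from a sample `z₁, …, z_N`. -/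
def empCVaR (α : ℝ) {N : ℕ} (z : Fin N → ℝ) : ℝ :=
  ⨅ η : ℝ, (η + ((N : ℝ) * α)⁻¹ * ∑ j, max (z j - η) 0)

variable {n m : ℕ}

/-- The map `F`, `F_i(h) = CVaR_α[C_i(h, ξ)]` with `ξ ∼ P`. -/
def cvarMap (α : ℝ) (P : Measure (E m)) (C : E n → E m → E n) (h : E n) : E n :=
  WithLp.toLp 2 fun i => cvar α P fun x => C h x i

/-- The estimator of `F(h)` from the sample `x₁, …, x_N` of `ξ`, which is common to all
components. -/
def empMap (α : ℝ) (C : E n → E m → E n) {N : ℕ} (x : Fin N → E m) (h : E n) : E n :=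
  WithLp.toLp 2 fun i => empCVaR α fun j => C h (x j) i

/-- `F` is strictly monotone on `ℝⁿ`. -/
def StrictlyMonotone (F : E n → E n) : Prop :=
  ∀ x y : E n, x ≠ y → 0 < inner ℝ (F x - F y) (x - y)

/-- The solution set `SOL(H, F)` of the variational inequality. -/
def viSol (H : Set (E n)) (F : E n → E n) : Set (E n) :=
  {x | x ∈ H ∧ ∀ y ∈ H, 0 ≤ inner ℝ (y - x) (F x)}

/-- The set `{h | A h = b, qⁱ(h) ≤ 0 for all i}`. -/
def feasibleSet {l s : ℕ} (A : Matrix (Fin l) (Fin n) ℝ) (b : Fin l → ℝ)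
    (q : Fin s → E n → ℝ) : Set (E n) :=
  {h | A.mulVec h.ofLp = b ∧ ∀ i, q i h ≤ 0}

/-- Euclidean projection: a point of `H` nearest to `x` (there is exactly one if `H` is
nonempty, closed and convex). -/
def proj (H : Set (E n)) (x : E n) : E n :=
  Classical.epsilon fun y => y ∈ H ∧ ∀ z ∈ H, ‖x - y‖ ≤ ‖x - z‖

/-- The iterates `h^{k+1} = Π_H (h^k - γ^k F̂^{N_k}(h^k))`, where `F̂^{N_k}` is computed from the
samples `ξ k j`, `j : Fin (N k)`, drawn at iteration `k`. -/
def iterates {Ω : Type*} (α : ℝ) (C : E n → E m → E n) (H : Set (E n)) (γ : ℕ → ℝ)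
    (N : ℕ → ℕ) (ξ : (k : ℕ) → Fin (N k) → Ω → E m) (h₀ : E n) : ℕ → Ω → E n
  | 0, _ => h₀
  | k + 1, ω =>
      proj H (iterates α C H γ N ξ h₀ k ω -
        γ k • empMap α C (fun j => ξ k j ω) (iterates α C H γ N ξ h₀ k ω))

/-- The estimation error `β̂^{N_k} = F̂^{N_k}(h^k) - F(h^k)`. -/
def estError {Ω : Type*} (α : ℝ) (P : Measure (E m)) (C : E n → E m → E n) (H : Set (E n))
    (γ : ℕ → ℝ) (N : ℕ → ℕ) (ξ : (k : ℕ) → Fin (N k) → Ω → E m) (h₀ : E n) (k : ℕ) (ω : Ω) :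
    E n :=
  empMap α C (fun j => ξ k j ω) (iterates α C H γ N ξ h₀ k ω) -
    cvarMap α P C (iterates α C H γ N ξ h₀ k ω)

end CVaRVI

end

/-!
Monotone variational inequalities on a compact convex set are solvable because finitely many of the
inequalities `⟪F y, y - x⟫ ≥ 0` always have a common solution in the convex hull of their points, by
the minimax theorem for the matrix game with payoff `⟪F y, y - z⟫`; compactness and Minty's lemma do
the rest, and strict monotonicity gives uniqueness together with a drift
`⟪F h, h - h*⟫ ≥ c > 0` for all `h ∈ H` at distance at least `ε / 2` from `h*`.

An almost sure bound `B` on the estimation error confines the costs to an interval of length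
`2B`: otherwise a whole sample would lie outside it with positive probability. The layer-cake
formula `𝔼[Z - η]⁺ = ∫_η^∞ P(Z > t) dt` then bounds the mean error of the empirical CVaR by the
integral over that interval of the mean deviation of the empirical tail function, at most
`1/(2√N)` for each `t`. So for large samples the conditional drift of the estimator is still at
least `c / 2`. What remains is a martingale difference, and square summability of the steps makes
its weighted sums converge almost surely; up to this convergent perturbation, `‖h^k - h*‖²`
decreases by a multiple of `γ^k` outside the ball of radius `ε / 2`, and the divergence of
`∑ γ^k` forces the iterates into the `ε`-ball.
-/

namespace CVaRVI

section Descent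

variable {U V γ r : ℕ → ℝ} {b ρ η c d L : ℝ}

lemma frequently_lt_of_descent (hb : ∀ᶠ k in atTop, b ≤ U k)
    (hγ : Tendsto (fun K => ∑ k ∈ Finset.range K, γ k) atTop atTop)
    (hdown : ∀ᶠ k in atTop, ρ ≤ U k → U (k + 1) ≤ U k - γ k) : ∃ᶠ k in atTop, U k < ρ := by
  by_contra hcon
  obtain ⟨K, hK⟩ := eventually_atTop.1 (hdown.and (not_frequently.1 hcon))
  have htelescope : ∀ k ≥ K, U k + ∑ i ∈ Finset.range k, γ i ≤
      U K + ∑ i ∈ Finset.range K, γ i := fun k hk => by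
    induction k, hk using Nat.le_induction with
    | base => exact le_rfl
    | succ k hk ih =>
      rw [Finset.sum_range_succ]
      linarith [(hK k hk).1 (not_lt.1 (hK k hk).2)]
  obtain ⟨k, hkb, hkγ, hkK⟩ := (hb.and ((hγ.eventually_gt_atTop
    (U K + ∑ i ∈ Finset.range K, γ i - b)).and (eventually_ge_atTop K))).exists
  linarith [htelescope k hkK]

lemma eventually_le_add_of_descent (hb : ∀ᶠ k in atTop, b ≤ U k) (hγ0 : ∀ k, 0 ≤ γ k)
    (hγ : Tendsto (fun K => ∑ k ∈ Finset.range K, γ k) atTop atTop)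
    (hdown : ∀ᶠ k in atTop, ρ ≤ U k → U (k + 1) ≤ U k - γ k) (hη : 0 ≤ η)
    (hup : ∀ᶠ k in atTop, U (k + 1) ≤ U k + η) : ∀ᶠ k in atTop, U k ≤ ρ + η := by
  obtain ⟨K, hK⟩ := eventually_atTop.1 (hdown.and hup)
  obtain ⟨k₀, hk₀, hUk₀⟩ := (frequently_lt_of_descent hb hγ hdown).forall_exists_of_atTop K
  filter_upwards [eventually_ge_atTop k₀] with k hk
  induction k, hk using Nat.le_induction with
  | base => linarith
  | succ k hk ih =>
    obtain ⟨hdownk, hupk⟩ := hK k (hk₀.trans hk)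
    rcases lt_or_ge (U k) ρ with h | h
    · linarith
    · linarith [hdownk h, hγ0 k]

/-- Adding the tail `∑_{j ≥ k} r j` to `V k` absorbs the perturbation. -/
lemma eventually_le_add_of_perturbed_descent (hV : ∀ k, 0 ≤ V k) (hc : 0 < c)
    (hγ0 : ∀ k, 0 ≤ γ k) (hγlim : Tendsto γ atTop (𝓝 0))
    (hγ : Tendsto (fun K => ∑ k ∈ Finset.range K, γ k) atTop atTop)
    (hr : Tendsto (fun K => ∑ k ∈ Finset.range K, r k) atTop (𝓝 L))
    (hdown : ∀ k, ρ ≤ V k → V (k + 1) ≤ V k - c * γ k + r k)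
    (hup : ∀ k, V (k + 1) ≤ V k + d * γ k + r k) (hη : 0 < η) :
    ∀ᶠ k in atTop, V k ≤ ρ + η := by
  set U : ℕ → ℝ := fun k => V k + (L - ∑ j ∈ Finset.range k, r j)
  have hU : ∀ k, U (k + 1) = U k + (V (k + 1) - V k - r k) := fun k => by
    simp only [U, Finset.sum_range_succ]; ring
  have htail : ∀ᶠ k in atTop, |L - ∑ j ∈ Finset.range k, r j| < η / 3 := by
    have h : Tendsto (fun k => L - ∑ j ∈ Finset.range k, r j) atTop (𝓝 0) := by
      simpa using hr.const_sub L
    simpa using h.abs.eventually_lt_const (by simpa using div_pos hη three_pos)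
  have hdγ : ∀ᶠ k in atTop, d * γ k < η / 3 :=
    (hγlim.const_mul d).eventually_lt_const (by simpa using div_pos hη three_pos)
  have hUle : ∀ᶠ k in atTop, U k ≤ ρ + η / 3 + η / 3 := by
    refine eventually_le_add_of_descent (γ := fun k => c * γ k) (b := -(η / 3)) ?_
      (fun k => mul_nonneg hc.le (hγ0 k)) ?_ ?_ (by positivity) ?_
    · filter_upwards [htail] with k hk
      linarith [hV k, (abs_lt.1 hk).1]
    · simpa only [← Finset.mul_sum] using hγ.const_mul_atTop hc
    · filter_upwards [htail] with k hk hρ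
      linarith [hU k, hdown k (by linarith [(abs_lt.1 hk).2])]
    · filter_upwards [hdγ] with k hk
      linarith [hU k, hup k]
  filter_upwards [hUle, htail] with k hUk hk
  linarith [(abs_lt.1 hk).1]

end Descent

section VariationalInequality

lemma exists_mem_stdSimplex_mulVec_nonneg {ι : Type*} [Fintype ι] [Nonempty ι]
    {a : Matrix ι ι ℝ} (ha : ∀ w ∈ stdSimplex ℝ ι, 0 ≤ w ⬝ᵥ a.mulVec w) :
    ∃ w ∈ stdSimplex ℝ ι, 0 ≤ a.mulVec w := by
  classical
  let f := Matrix.toLinearMap₂' ℝ (S₁ := ℝ) (S₂ := ℝ) a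
  have hf : ∀ u w, f u w = u ⬝ᵥ a.mulVec w := Matrix.toLinearMap₂'_apply' a
  have hconv := convex_stdSimplex ℝ ι
  have hcomp := isCompact_stdSimplex ℝ ι
  have hne : (stdSimplex ℝ ι).Nonempty := ⟨_, single_mem_stdSimplex ℝ (Classical.arbitrary ι)⟩
  obtain ⟨u, hu, w, hw, hsaddle⟩ := Sion.exists_isSaddlePointOn' (f := fun u w => f u w) hne hcomp
    (fun w _ => (f.flip w).continuous_of_finiteDimensional.lowerSemicontinuous.lowerSemicontinuousOn
      _)
    (fun w _ => ((f.flip w).convexOn hconv).quasiconvexOn) hconv hcomp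
    (fun u _ => (f u).continuous_of_finiteDimensional.upperSemicontinuous.upperSemicontinuousOn _)
    (fun u _ => ((f u).concaveOn hconv).quasiconcaveOn) hconv hne
  refine ⟨w, hw, fun i => ?_⟩
  calc 0 ≤ u ⬝ᵥ a.mulVec u := ha u hu
    _ ≤ Pi.single i 1 ⬝ᵥ a.mulVec w := by
      simpa only [hf] using hsaddle _ (single_mem_stdSimplex ℝ i) u hu
    _ = a.mulVec w i := single_one_dotProduct _ _

/-- The symmetric part of the payoff `⟪v i, p i - p j⟫` is the monotonicity form. -/
lemma sum_sum_mul_inner_sub_nonneg {V ι : Type*} [NormedAddCommGroup V] [InnerProductSpace ℝ V]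
    [Fintype ι] {p v : ι → V} (hv : ∀ i j, 0 ≤ inner ℝ (v i - v j) (p i - p j)) {w : ι → ℝ}
    (hw : ∀ i, 0 ≤ w i) : 0 ≤ ∑ i, ∑ j, w i * w j * inner ℝ (v i) (p i - p j) := by
  have hsymm : 2 * ∑ i, ∑ j, w i * w j * inner ℝ (v i) (p i - p j) =
      ∑ i, ∑ j, w i * w j * inner ℝ (v i - v j) (p i - p j) := by
    rw [two_mul]
    nth_rw 2 [Finset.sum_comm]
    simp only [← Finset.sum_add_distrib]
    refine Finset.sum_congr rfl fun i _ => Finset.sum_congr rfl fun j _ => ?_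
    rw [← neg_sub (p i) (p j), inner_neg_right, inner_sub_left]
    ring
  have hnonneg := Finset.sum_nonneg fun i (_ : i ∈ Finset.univ) => Finset.sum_nonneg
    fun j (_ : j ∈ Finset.univ) => mul_nonneg (mul_nonneg (hw i) (hw j)) (hv i j)
  linarith

lemma exists_mem_convexHull_inner_sub_nonneg {V ι : Type*} [NormedAddCommGroup V]
    [InnerProductSpace ℝ V] [Finite ι] [Nonempty ι] {p v : ι → V}
    (hv : ∀ i j, 0 ≤ inner ℝ (v i - v j) (p i - p j)) :
    ∃ x ∈ convexHull ℝ (Set.range p), ∀ i, 0 ≤ inner ℝ (v i) (p i - x) := by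
  have := Fintype.ofFinite ι
  obtain ⟨w, hw, hpos⟩ := exists_mem_stdSimplex_mulVec_nonneg
    (a := Matrix.of fun i j => inner ℝ (v i) (p i - p j)) fun w hw => by
      simpa only [dotProduct, Matrix.mulVec, Matrix.of_apply, Finset.mul_sum,
        mul_comm (inner ℝ _ _), ← mul_assoc] using sum_sum_mul_inner_sub_nonneg hv hw.1
  refine ⟨∑ j, w j • p j, (convex_convexHull ℝ _).sum_mem (fun j _ => hw.1 j) hw.2
    fun j _ => subset_convexHull ℝ _ (Set.mem_range_self j), fun i => (hpos i).trans_eq ?_⟩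
  have hcenter : p i - ∑ j, w j • p j = ∑ j, w j • (p i - p j) := by
    simp_rw [smul_sub, Finset.sum_sub_distrib, ← Finset.sum_smul, hw.2, one_smul]
  rw [hcenter, inner_sum]
  simp only [Matrix.mulVec, dotProduct, Matrix.of_apply, inner_smul_right, mul_comm]

variable {n : ℕ} {F : E n → E n} {H : Set (E n)} {hstar : E n}

/-- Strict monotonicity of a vector field on the set `H`: the inequality of `StrictlyMonotone` for
points of `H`, which is all that a variational inequality over `H` sees. -/
def StrictlyMonotoneOn (F : E n → E n) (H : Set (E n)) : Prop :=
  ∀ x ∈ H, ∀ y ∈ H, x ≠ y → 0 < inner ℝ (F x - F y) (x - y)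

lemma StrictlyMonotone.strictlyMonotoneOn (hF : StrictlyMonotone F) (H : Set (E n)) :
    StrictlyMonotoneOn F H :=
  fun x _ y _ => hF x y

lemma StrictlyMonotoneOn.inner_sub_nonneg (hF : StrictlyMonotoneOn F H) {x y : E n} (hx : x ∈ H)
    (hy : y ∈ H) : 0 ≤ inner ℝ (F x - F y) (x - y) := by
  rcases eq_or_ne x y with rfl | hxy
  · simp
  · exact (hF x hx y hy hxy).le

/-- Minty's lemma. -/
lemma mem_viSol_of_forall_inner_nonneg (hconv : Convex ℝ H) (hF : ContinuousOn F H) {x : E n}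
    (hx : x ∈ H) (hweak : ∀ y ∈ H, 0 ≤ inner ℝ (F y) (y - x)) : x ∈ viSol H F := by
  refine ⟨hx, fun y hy => ?_⟩
  have hsegment : ∀ t ∈ Set.Icc (0 : ℝ) 1, x + t • (y - x) ∈ H := fun t ht =>
    hconv.add_smul_sub_mem hx hy ht
  have hcont : ContinuousOn (fun t : ℝ => inner ℝ (y - x) (F (x + t • (y - x)))) (Set.Icc 0 1) :=
    continuousOn_const.inner (hF.comp (by fun_prop) hsegment)
  have hlim : Tendsto (fun t : ℝ => inner ℝ (y - x) (F (x + t • (y - x)))) (𝓝[>] 0)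
      (𝓝 (inner ℝ (y - x) (F x))) := by
    simpa using
      ((hcont 0 (by simp)).mono_of_mem_nhdsWithin (Icc_mem_nhdsGT zero_lt_one)).tendsto
  refine ge_of_tendsto hlim ?_
  filter_upwards [Ioo_mem_nhdsGT (zero_lt_one' ℝ)] with t ht
  have hweakt := hweak _ (hsegment t (Set.Ioo_subset_Icc_self ht))
  rw [add_sub_cancel_left, inner_smul_right, real_inner_comm] at hweakt
  exact nonneg_of_mul_nonneg_right hweakt ht.1

lemma viSol_nonempty (hconv : Convex ℝ H) (hcomp : IsCompact H) (hne : H.Nonempty)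
    (hmono : ∀ x ∈ H, ∀ y ∈ H, 0 ≤ inner ℝ (F x - F y) (x - y)) (hF : ContinuousOn F H) :
    (viSol H F).Nonempty := by
  obtain ⟨x, hx, hweak⟩ := hcomp.inter_iInter_nonempty
    (fun y : H => {x : E n | 0 ≤ inner ℝ (F y) ((y : E n) - x)})
    (fun y => isClosed_le continuous_const (by fun_prop)) fun u => by
      rcases u.eq_empty_or_nonempty with rfl | hu
      · simpa using hne
      have : Nonempty u := hu.to_subtype
      obtain ⟨x, hx, hxu⟩ := exists_mem_convexHull_inner_sub_nonneg
        (p := fun y : u => ((y : H) : E n)) fun i j => hmono _ i.1.2 _ j.1.2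
      exact ⟨x, convexHull_min (Set.range_subset_iff.2 fun y => y.1.2) hconv hx,
        Set.mem_iInter₂.2 fun y hy => hxu ⟨y, hy⟩⟩
  exact ⟨x, mem_viSol_of_forall_inner_nonneg hconv hF hx fun y hy => Set.mem_iInter.1 hweak ⟨y, hy⟩⟩

lemma le_inner_of_mem_viSol (hsol : hstar ∈ viSol H F) {h : E n} (hh : h ∈ H) :
    inner ℝ (F h - F hstar) (h - hstar) ≤ inner ℝ (F h) (h - hstar) := by
  have hvi := hsol.2 h hh
  rw [inner_sub_left, real_inner_comm (h - hstar) (F hstar)]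
  exact sub_le_self _ hvi

lemma StrictlyMonotoneOn.exists_viSol_eq_singleton (hF : StrictlyMonotoneOn F H)
    (hFcont : ContinuousOn F H) (hconv : Convex ℝ H) (hcomp : IsCompact H) (hne : H.Nonempty) :
    ∃ x, viSol H F = {x} := by
  obtain ⟨x, hx⟩ := viSol_nonempty hconv hcomp hne (fun _ hx _ hy => hF.inner_sub_nonneg hx hy)
    hFcont
  refine ⟨x, Set.eq_singleton_iff_unique_mem.2 ⟨hx, fun y hy => ?_⟩⟩
  by_contra hyx
  have hpos : 0 < inner ℝ (F y) (y - x) :=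
    (hF y hy.1 x hx.1 hyx).trans_le (le_inner_of_mem_viSol hx hy.1)
  have hneg := hy.2 x hx.1
  rw [← neg_sub, inner_neg_left, real_inner_comm] at hneg
  linarith

lemma StrictlyMonotoneOn.exists_pos_le_inner (hF : StrictlyMonotoneOn F H)
    (hFcont : ContinuousOn F H) (hcomp : IsCompact H) (hsol : hstar ∈ viSol H F) {ρ : ℝ}
    (hρ : 0 < ρ) : ∃ c > 0, ∀ h ∈ H, ρ ≤ ‖h - hstar‖ → c ≤ inner ℝ (F h) (h - hstar) := by
  set A := H ∩ {h | ρ ≤ ‖h - hstar‖}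
  have hA : IsCompact A := hcomp.inter_right (isClosed_le continuous_const (by fun_prop))
  rcases A.eq_empty_or_nonempty with hempty | hne
  · exact ⟨1, one_pos, fun h hh hρh => (hempty.subset ⟨hh, hρh⟩).elim⟩
  have hcont : ContinuousOn (fun h => inner ℝ (F h) (h - hstar)) A :=
    (hFcont.mono Set.inter_subset_left).inner (by fun_prop)
  obtain ⟨x, ⟨hxH, hρx⟩, hmin⟩ := hA.exists_isMinOn hne hcont
  have hx : x ≠ hstar := sub_ne_zero.1 (norm_pos_iff.1 (hρ.trans_le hρx))
  exact ⟨_, (hF x hxH hstar hsol.1 hx).trans_le (le_inner_of_mem_viSol hsol hxH),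
    fun h hh hρh => hmin ⟨hh, hρh⟩⟩

lemma convex_feasibleSet {l s : ℕ} (A : Matrix (Fin l) (Fin n) ℝ) (b : Fin l → ℝ)
    {q : Fin s → E n → ℝ} (hq : ∀ i, ConvexOn ℝ Set.univ (q i)) :
    Convex ℝ (feasibleSet A b q) := by
  have hlin : Convex ℝ {h : E n | A.mulVec h.ofLp = b} :=
    (convex_singleton b).linear_preimage (A.mulVecLin ∘ₗ (WithLp.linearEquiv 2 ℝ _).toLinearMap)
  have hineq : Convex ℝ {h : E n | ∀ i, q i h ≤ 0} := by
    simpa only [Set.ofPred_forall, Set.mem_univ, true_and] using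
      convex_iInter fun i => (hq i).convex_le 0
  exact hlin.inter hineq

end VariationalInequality

section Projection

variable {n : ℕ} {H : Set (E n)}

lemma proj_mem_and_forall_norm_sub_le (hclosed : IsClosed H) (hne : H.Nonempty) (x : E n) :
    proj H x ∈ H ∧ ∀ z ∈ H, ‖x - proj H x‖ ≤ ‖x - z‖ := by
  obtain ⟨y, hy, hdist⟩ := hclosed.exists_infDist_eq_dist hne x
  refine Classical.epsilon_spec (p := fun y => y ∈ H ∧ ∀ z ∈ H, ‖x - y‖ ≤ ‖x - z‖)
    ⟨y, hy, fun z hz => ?_⟩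
  rw [← dist_eq_norm, ← dist_eq_norm, ← hdist]
  exact Metric.infDist_le_dist_of_mem hz

lemma proj_mem (hclosed : IsClosed H) (hne : H.Nonempty) (x : E n) : proj H x ∈ H :=
  (proj_mem_and_forall_norm_sub_le hclosed hne x).1

lemma proj_eq_self (hclosed : IsClosed H) {x : E n} (hx : x ∈ H) : proj H x = x := by
  have h := (proj_mem_and_forall_norm_sub_le hclosed ⟨x, hx⟩ x).2 x hx
  rw [sub_self, norm_zero, norm_le_zero_iff, sub_eq_zero] at h
  exact h.symm

lemma inner_sub_proj_nonpos (hconv : Convex ℝ H) (hclosed : IsClosed H) (x : E n) {z : E n}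
    (hz : z ∈ H) : inner ℝ (x - proj H x) (z - proj H x) ≤ 0 := by
  obtain ⟨hmem, hmin⟩ := proj_mem_and_forall_norm_sub_le hclosed ⟨z, hz⟩ x
  have : Nonempty H := ⟨z, hz⟩
  refine (norm_eq_iInf_iff_real_inner_le_zero hconv hmem).1 ?_ z hz
  exact le_antisymm (le_ciInf fun w => hmin w w.2)
    (ciInf_le ⟨0, Set.forall_mem_range.2 fun _ => norm_nonneg _⟩ (⟨_, hmem⟩ : H))

lemma norm_proj_sub_proj_le (hconv : Convex ℝ H) (hclosed : IsClosed H) (hne : H.Nonempty)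
    (x y : E n) : ‖proj H x - proj H y‖ ≤ ‖x - y‖ := by
  have hx := inner_sub_proj_nonpos hconv hclosed x (proj_mem hclosed hne y)
  have hy := inner_sub_proj_nonpos hconv hclosed y (proj_mem hclosed hne x)
  set p := proj H x
  set q := proj H y
  have hexpand : inner ℝ (x - y) (p - q) =
      ‖p - q‖ ^ 2 - inner ℝ (x - p) (q - p) - inner ℝ (y - q) (p - q) := by
    rw [← real_inner_self_eq_norm_sq, ← neg_sub p q, inner_neg_right, sub_neg_eq_add,
      ← inner_add_left, ← inner_sub_left]
    congr 1
    abel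
  have hsq : ‖p - q‖ * ‖p - q‖ ≤ ‖x - y‖ * ‖p - q‖ := by
    linarith [real_inner_le_norm (x - y) (p - q)]
  rcases (norm_nonneg (p - q)).eq_or_lt with hzero | hpos
  · rw [← hzero]
    exact norm_nonneg _
  · exact le_of_mul_le_mul_right hsq hpos

lemma continuous_proj (hconv : Convex ℝ H) (hclosed : IsClosed H) (hne : H.Nonempty) :
    Continuous (proj H) :=
  (LipschitzWith.of_dist_le_mul (K := 1) fun x y => by
    simpa [dist_eq_norm] using norm_proj_sub_proj_le hconv hclosed hne x y).continuous

lemma norm_proj_sub_smul_sub_sq_le (hconv : Convex ℝ H) (hclosed : IsClosed H) {x : E n}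
    (hx : x ∈ H) (h v : E n) (t : ℝ) :
    ‖proj H (h - t • v) - x‖ ^ 2 ≤
      ‖h - x‖ ^ 2 - 2 * t * inner ℝ v (h - x) + t ^ 2 * ‖v‖ ^ 2 := by
  have hle : ‖proj H (h - t • v) - x‖ ≤ ‖h - t • v - x‖ := by
    simpa only [proj_eq_self hclosed hx] using
      norm_proj_sub_proj_le hconv hclosed ⟨x, hx⟩ (h - t • v) x
  refine (pow_le_pow_left₀ (norm_nonneg _) hle 2).trans_eq ?_
  rw [sub_right_comm, norm_sub_sq_real, inner_smul_right, norm_smul, mul_pow, Real.norm_eq_abs,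
    sq_abs, real_inner_comm]
  ring

end Projection

section Martingale

variable {Ω : Type*} {m mΩ : MeasurableSpace Ω} {μ : Measure Ω}

lemma condExp_prod_ae_eq_integral_map_of_indepFun {S T : Type*} [MeasurableSpace S]
    [MeasurableSpace T] [StandardBorelSpace T] [Nonempty T] [IsFiniteMeasure μ] {X : Ω → S}
    {Y : Ω → T} (hX : Measurable X) (hY : Measurable Y) (hind : IndepFun X Y μ) {f : S × T → ℝ}
    (hf : Measurable f) (hfi : Integrable (fun ω => f (X ω, Y ω)) μ) :
    μ[fun ω => f (X ω, Y ω) | MeasurableSpace.comap X inferInstance] =ᵐ[μ]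
      fun ω => ∫ y, f (X ω, y) ∂(μ.map Y) := by
  have hdistrib : condDistrib Y X μ =ᵐ[μ.map X] fun _ => μ.map Y :=
    condDistrib_ae_eq_of_measure_eq_compProd (κ := Kernel.const S (μ.map Y)) X hY.aemeasurable <| by
      rw [Measure.compProd_const]
      exact (indepFun_iff_map_prod_eq_prod_map_map hX.aemeasurable hY.aemeasurable).1 hind
  filter_upwards [condExp_prod_ae_eq_integral_condDistrib hX hY.aemeasurable hf.stronglyMeasurable
    hfi, ae_of_ae_map hX.aemeasurable hdistrib] with ω hω hω'
  rw [hω, hω']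

lemma condExp_prod_ae_eq_integral_map_of_indep {S T : Type*} [MeasurableSpace S]
    [MeasurableSpace T] [StandardBorelSpace T] [Nonempty T] [IsFiniteMeasure μ] (hm : m ≤ mΩ)
    {X : Ω → S} {Y : Ω → T} (hX : Measurable[m] X) (hY : Measurable Y)
    (hind : Indep m (MeasurableSpace.comap Y inferInstance) μ) {f : S × T → ℝ} (hf : Measurable f)
    (hfi : Integrable (fun ω => f (X ω, Y ω)) μ) :
    μ[fun ω => f (X ω, Y ω) | m] =ᵐ[μ] fun ω => ∫ y, f (X ω, y) ∂(μ.map Y) := by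
  have hid : @Measurable Ω Ω mΩ m id := measurable_id'' hm
  have hfX : @Measurable (Ω × T) ℝ (@Prod.instMeasurableSpace _ _ m _) _
      fun p : Ω × T => f (X p.1, p.2) :=
    hf.comp ((hX.comp measurable_fst).prodMk measurable_snd)
  have hindid : @IndepFun Ω Ω T mΩ m _ id Y μ := by
    rwa [@IndepFun_iff_Indep, MeasurableSpace.comap_id]
  simpa only [MeasurableSpace.comap_id, id] using
    @condExp_prod_ae_eq_integral_map_of_indepFun Ω mΩ μ Ω T m _ _ _ _ id Y hid hY hindid _ hfX hfi

lemma ae_ae_map_of_indepFun [IsFiniteMeasure μ] {S T : Type*} [MeasurableSpace S]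
    [MeasurableSpace T] {X : Ω → S} {Y : Ω → T} (hX : Measurable X) (hY : Measurable Y)
    (hind : IndepFun X Y μ) {p : S × T → Prop} (hp : MeasurableSet {z | p z})
    (h : ∀ᵐ ω ∂μ, p (X ω, Y ω)) : ∀ᵐ ω ∂μ, ∀ᵐ y ∂(μ.map Y), p (X ω, y) := by
  rw [← ae_map_iff (hX.prodMk hY).aemeasurable hp,
    (indepFun_iff_map_prod_eq_prod_map_map hX.aemeasurable hY.aemeasurable).1 hind] at h
  exact ae_of_ae_map hX.aemeasurable (Measure.ae_ae_of_ae_prod h)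

variable [IsFiniteMeasure μ]

lemma integral_mul_eq_zero_of_condExp_eq_zero (hm : m ≤ mΩ) {f g : Ω → ℝ}
    (hf : StronglyMeasurable[m] f) (hf2 : MemLp f 2 μ) (hg2 : MemLp g 2 μ)
    (hcond : μ[g | m] =ᵐ[μ] 0) : ∫ ω, f ω * g ω ∂μ = 0 := by
  have hpull : μ[f * g | m] =ᵐ[μ] 0 := by
    filter_upwards [condExp_mul_of_stronglyMeasurable_left hf (hf2.integrable_mul hg2)
      (hg2.integrable one_le_two), hcond] with ω hω hω'
    rw [hω, Pi.mul_apply, hω', Pi.zero_apply, mul_zero]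
  calc ∫ ω, f ω * g ω ∂μ = ∫ ω, (μ[f * g | m]) ω ∂μ := (integral_condExp hm).symm
    _ = 0 := by rw [integral_congr_ae hpull, Pi.zero_def, integral_zero]

variable {ℱ : Filtration ℕ mΩ} {D : ℕ → Ω → ℝ}

lemma stronglyMeasurable_sum_range (hD : ∀ k, StronglyMeasurable[ℱ (k + 1)] (D k)) (k : ℕ) :
    StronglyMeasurable[ℱ k] fun ω => ∑ j ∈ Finset.range k, D j ω :=
  Finset.stronglyMeasurable_fun_sum _ fun j hj => (hD j).mono (ℱ.mono (Finset.mem_range.1 hj))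

lemma martingale_sum_range (hD : ∀ k, StronglyMeasurable[ℱ (k + 1)] (D k))
    (hDi : ∀ k, Integrable (D k) μ) (hcond : ∀ k, μ[D k | ℱ k] =ᵐ[μ] 0) :
    Martingale (fun k ω => ∑ j ∈ Finset.range k, D j ω) ℱ μ := by
  refine martingale_of_condExp_sub_eq_zero_nat (stronglyMeasurable_sum_range hD)
    (fun k => integrable_finsetSum _ fun j _ => hDi j) fun k => ?_
  convert hcond k using 2
  ext ω
  simp [Finset.sum_range_succ]

lemma integral_sq_sum_range (hD : ∀ k, StronglyMeasurable[ℱ (k + 1)] (D k))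
    (hD2 : ∀ k, MemLp (D k) 2 μ) (hcond : ∀ k, μ[D k | ℱ k] =ᵐ[μ] 0) (k : ℕ) :
    ∫ ω, (∑ j ∈ Finset.range k, D j ω) ^ 2 ∂μ = ∑ j ∈ Finset.range k, ∫ ω, D j ω ^ 2 ∂μ := by
  induction k with
  | zero => simp
  | succ k ih =>
    have hsum : MemLp (fun ω => ∑ j ∈ Finset.range k, D j ω) 2 μ :=
      memLp_finsetSum _ fun j _ => hD2 j
    have hcross : Integrable (fun ω => (∑ j ∈ Finset.range k, D j ω) * D k ω) μ :=
      hsum.integrable_mul (hD2 k)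
    have horth := integral_mul_eq_zero_of_condExp_eq_zero (ℱ.le k)
      (stronglyMeasurable_sum_range hD k) hsum (hD2 k) (hcond k)
    simp_rw [Finset.sum_range_succ, add_sq, mul_assoc]
    rw [integral_add (by exact hsum.integrable_sq.add (hcross.const_mul 2)) (hD2 k).integrable_sq,
      integral_add hsum.integrable_sq (hcross.const_mul 2), integral_const_mul, horth, ih, mul_zero,
      add_zero]

lemma ae_exists_tendsto_sum_range (hD : ∀ k, StronglyMeasurable[ℱ (k + 1)] (D k))
    (hD2 : ∀ k, MemLp (D k) 2 μ) (hcond : ∀ k, μ[D k | ℱ k] =ᵐ[μ] 0)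
    (hsum : Summable fun k => ∫ ω, D k ω ^ 2 ∂μ) :
    ∀ᵐ ω ∂μ, ∃ L, Tendsto (fun k => ∑ j ∈ Finset.range k, D j ω) atTop (𝓝 L) := by
  have hmart := martingale_sum_range hD (fun k => (hD2 k).integrable one_le_two) hcond
  refine hmart.submartingale.exists_ae_tendsto_of_bdd
    (R := Real.toNNReal (∑' k, ∫ ω, D k ω ^ 2 ∂μ + μ.real Set.univ)) fun k => ?_
  have hS2 : MemLp (fun ω => ∑ j ∈ Finset.range k, D j ω) 2 μ := memLp_finsetSum _ fun j _ => hD2 j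
  rw [eLpNorm_one_eq_lintegral_enorm,
    ← ofReal_integral_norm_eq_lintegral_enorm (hmart.integrable k)]
  refine ENNReal.ofReal_le_ofReal ?_
  calc ∫ ω, ‖∑ j ∈ Finset.range k, D j ω‖ ∂μ
      ≤ ∫ ω, ((∑ j ∈ Finset.range k, D j ω) ^ 2 + 1) ∂μ := by
        refine integral_mono (hmart.integrable k).norm
          (hS2.integrable_sq.add (integrable_const 1)) fun ω => ?_
        rw [Real.norm_eq_abs, ← sq_abs]
        nlinarith [sq_nonneg (|∑ j ∈ Finset.range k, D j ω| - 1)]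
    _ = ∑ j ∈ Finset.range k, ∫ ω, D j ω ^ 2 ∂μ + μ.real Set.univ := by
        rw [integral_add hS2.integrable_sq (integrable_const 1), integral_sq_sum_range hD hD2 hcond]
        simp
    _ ≤ ∑' k, ∫ ω, D k ω ^ 2 ∂μ + μ.real Set.univ := by
        gcongr
        exact hsum.sum_le_tsum _ fun j _ => integral_nonneg fun ω => sq_nonneg _

lemma ae_exists_tendsto_sum_range_mul {Y : ℕ → Ω → ℝ} {γ : ℕ → ℝ} {K : ℝ}
    (hY : ∀ k, StronglyMeasurable[ℱ (k + 1)] (Y k)) (hK : ∀ k, ∀ᵐ ω ∂μ, |Y k ω| ≤ K)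
    (hcond : ∀ k, μ[Y k | ℱ k] =ᵐ[μ] 0) (hγ : Summable fun k => γ k ^ 2) :
    ∀ᵐ ω ∂μ, ∃ L, Tendsto (fun k => ∑ j ∈ Finset.range k, γ j * Y j ω) atTop (𝓝 L) := by
  have hY2 : ∀ k, MemLp (Y k) 2 μ := fun k =>
    MemLp.of_bound ((hY k).mono (ℱ.le _)).aestronglyMeasurable K (hK k)
  refine ae_exists_tendsto_sum_range (fun k => (hY k).const_mul (γ k))
    (fun k => (hY2 k).const_mul (γ k)) (fun k => ?_) ?_
  · filter_upwards [condExp_smul (μ := μ) (γ k) (Y k) (ℱ k), hcond k] with ω hω hω'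
    refine hω.trans ?_
    rw [Pi.smul_apply, hω', Pi.zero_apply, smul_zero]
  · simp_rw [mul_pow, integral_const_mul]
    refine (hγ.mul_right (μ.real Set.univ * K ^ 2)).of_nonneg_of_le
      (fun k => mul_nonneg (sq_nonneg _) (integral_nonneg fun ω => sq_nonneg _)) fun k => ?_
    gcongr
    calc ∫ ω, Y k ω ^ 2 ∂μ ≤ ∫ _, K ^ 2 ∂μ := by
          refine integral_mono_ae (hY2 k).integrable_sq (integrable_const _) ?_
          filter_upwards [hK k] with ω hω
          exact sq_le_sq' (abs_le.1 hω).1 (abs_le.1 hω).2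
      _ = μ.real Set.univ * K ^ 2 := by simp

lemma ae_exists_tendsto_sum_range_mul_sub_condExp {Z : ℕ → Ω → ℝ} {γ : ℕ → ℝ} {K : ℝ}
    (hZ : ∀ k, StronglyMeasurable[ℱ (k + 1)] (Z k)) (hK : ∀ k, ∀ᵐ ω ∂μ, |Z k ω| ≤ K)
    (hγ : Summable fun k => γ k ^ 2) :
    ∀ᵐ ω ∂μ, ∃ L, Tendsto
      (fun k => ∑ j ∈ Finset.range k, γ j * (Z j ω - (μ[Z j | ℱ j]) ω)) atTop (𝓝 L) := by
  have hZi : ∀ k, Integrable (Z k) μ := fun k =>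
    Integrable.of_bound ((hZ k).mono (ℱ.le _)).aestronglyMeasurable K (hK k)
  refine ae_exists_tendsto_sum_range_mul (Y := fun k ω => Z k ω - (μ[Z k | ℱ k]) ω) (K := K + K)
    (fun k => (hZ k).sub (stronglyMeasurable_condExp.mono (ℱ.mono k.le_succ))) (fun k => ?_)
    (fun k => ?_) hγ
  · filter_upwards [hK k, ae_bdd_abs_condExp_of_ae_bdd_abs (m := ℱ k) (hK k)] with ω hω hω'
    exact (abs_sub _ _).trans (add_le_add hω hω')
  · filter_upwards [condExp_sub (hZi k) (integrable_condExp (f := Z k) (m := ℱ k)) (ℱ k)] with ω hω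
    refine hω.trans ?_
    rw [condExp_of_stronglyMeasurable (ℱ.le k) stronglyMeasurable_condExp integrable_condExp,
      Pi.sub_apply, sub_self, Pi.zero_apply]

end Martingale

section ProjectedIteration

variable {n : ℕ} {H : Set (E n)} {x : E n} {γ : ℕ → ℝ} {c M ρ ε : ℝ}

lemma eventually_norm_sub_le_of_forall_eq_proj (hconv : Convex ℝ H) (hclosed : IsClosed H)
    (hx : x ∈ H) {h v : ℕ → E n} (hrec : ∀ k, h (k + 1) = proj H (h k - γ k • v k))
    (hv : ∀ k, ‖v k‖ ≤ M) {p : ℕ → ℝ} {d : ℝ} (hd : ∀ k, d ≤ p k) (hc : 0 < c)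
    (hgap : ∀ k, ρ ≤ ‖h k - x‖ → c ≤ p k) (hγ0 : ∀ k, 0 ≤ γ k)
    (hγ : Tendsto (fun K => ∑ k ∈ Finset.range K, γ k) atTop atTop)
    (hγ2 : Summable fun k => γ k ^ 2) {L : ℝ}
    (hnoise : Tendsto (fun K => ∑ k ∈ Finset.range K, γ k * (inner ℝ (v k) (h k - x) - p k)) atTop
      (𝓝 L)) (hρ : 0 ≤ ρ) (hρε : ρ < ε) : ∀ᶠ k in atTop, ‖h k - x‖ ≤ ε := by
  set Y : ℕ → ℝ := fun k => inner ℝ (v k) (h k - x) - p k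
  have hγlim : Tendsto γ atTop (𝓝 0) := by
    simpa [Function.comp_def, Real.sqrt_sq, hγ0] using
      Real.continuous_sqrt.continuousAt.tendsto.comp hγ2.tendsto_atTop_zero
  have hr : Tendsto (fun K => ∑ k ∈ Finset.range K, (γ k ^ 2 * M ^ 2 - 2 * (γ k * Y k))) atTop
      (𝓝 ((∑' k, γ k ^ 2) * M ^ 2 - 2 * L)) := by
    simpa only [Finset.sum_sub_distrib, ← Finset.sum_mul, ← Finset.mul_sum] using
      (hγ2.hasSum.tendsto_sum_nat.mul_const _).sub (hnoise.const_mul 2)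
  have hstep : ∀ k, ‖h (k + 1) - x‖ ^ 2 ≤
      ‖h k - x‖ ^ 2 - 2 * γ k * p k + (γ k ^ 2 * M ^ 2 - 2 * (γ k * Y k)) := fun k => by
    have hproj := norm_proj_sub_smul_sub_sq_le hconv hclosed hx (h k) (v k) (γ k)
    have hvk : γ k ^ 2 * ‖v k‖ ^ 2 ≤ γ k ^ 2 * M ^ 2 := by
      gcongr
      exact hv k
    have hinner : inner ℝ (v k) (h k - x) = p k + Y k := (add_sub_cancel _ _).symm
    rw [hrec]
    rw [hinner] at hproj
    linarith
  have hsq := eventually_le_add_of_perturbed_descent (V := fun k => ‖h k - x‖ ^ 2) (c := 2 * c)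
    (d := -2 * d) (ρ := ρ ^ 2) (η := ε ^ 2 - ρ ^ 2) (fun k => sq_nonneg _) (by positivity) hγ0 hγlim
    hγ hr
    (fun k hk => by
      have hgapk := hgap k (le_of_sq_le_sq hk (norm_nonneg _))
      nlinarith [hstep k, hγ0 k])
    (fun k => by nlinarith [hstep k, hγ0 k, hd k])
    (sub_pos.2 (by gcongr))
  filter_upwards [hsq] with k hk
  exact le_of_sq_le_sq (hk.trans_eq (by ring)) (hρ.trans hρε.le)

/-- Only the conditional drift of the search direction matters: its fluctuation is a martingale
difference, which the square-summable steps average out. -/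
lemma ae_eventually_norm_sub_le_of_le_condExp {Ω : Type*} {mΩ : MeasurableSpace Ω} {μ : Measure Ω}
    [IsFiniteMeasure μ] {ℱ : Filtration ℕ mΩ} {h v : ℕ → Ω → E n} (hconv : Convex ℝ H)
    (hcomp : IsCompact H) (hx : x ∈ H) (hhm : ∀ k, Measurable[ℱ k] (h k))
    (hvm : ∀ k, Measurable[ℱ (k + 1)] (v k)) (hhH : ∀ k ω, h k ω ∈ H)
    (hrec : ∀ k ω, h (k + 1) ω = proj H (h k ω - γ k • v k ω)) (hv : ∀ᵐ ω ∂μ, ∀ k, ‖v k ω‖ ≤ M)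
    (hγ0 : ∀ k, 0 ≤ γ k) (hγ : Tendsto (fun K => ∑ k ∈ Finset.range K, γ k) atTop atTop)
    (hγ2 : Summable fun k => γ k ^ 2) (hc : 0 < c)
    (hgap : ∀ k, ∀ᵐ ω ∂μ, ρ ≤ ‖h k ω - x‖ →
      c ≤ (μ[fun ω => inner ℝ (v k ω) (h k ω - x) | ℱ k]) ω) (hρ : 0 ≤ ρ) (hρε : ρ < ε) :
    ∀ᵐ ω ∂μ, ∀ᶠ k in atTop, ‖h k ω - x‖ ≤ ε := by
  obtain ⟨R, hR⟩ := hcomp.isBounded.exists_norm_le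
  set Z : ℕ → Ω → ℝ := fun k ω => inner ℝ (v k ω) (h k ω - x)
  have hZm : ∀ k, StronglyMeasurable[ℱ (k + 1)] (Z k) := fun k =>
    ((hvm k).inner (((hhm k).mono (ℱ.mono k.le_succ) le_rfl).sub_const x)).stronglyMeasurable
  have hZ : ∀ k, ∀ᵐ ω ∂μ, |Z k ω| ≤ M * (R + ‖x‖) := fun k => by
    filter_upwards [hv] with ω hω
    refine (abs_real_inner_le_norm _ _).trans ?_
    have hhx : ‖h k ω - x‖ ≤ R + ‖x‖ := norm_sub_le_of_le (hR _ (hhH k ω)) le_rfl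
    exact mul_le_mul (hω k) hhx (norm_nonneg _) ((norm_nonneg _).trans (hω k))
  filter_upwards [hv, ae_all_iff.2 hgap,
    ae_all_iff.2 fun k => ae_bdd_abs_condExp_of_ae_bdd_abs (m := ℱ k) (hZ k),
    ae_exists_tendsto_sum_range_mul_sub_condExp hZm hZ hγ2] with ω hvω hgapω hpω ⟨L, hL⟩
  exact eventually_norm_sub_le_of_forall_eq_proj hconv hcomp.isClosed hx (fun k => hrec k ω) hvω
    (fun k => (abs_le.1 (hpω k)).1) hc hgapω hγ0 hγ hγ2 hL hρ hρε

end ProjectedIteration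

section Tail

variable {S : Type*} [MeasurableSpace S] {P : Measure S} {Z : S → ℝ} {η : ℝ}

lemma setOf_lt_max_sub_zero {S : Type*} (Z : S → ℝ) (η : ℝ) {t : ℝ} (ht : 0 < t) :
    {x | t < max (Z x - η) 0} = {x | t + η < Z x} := by
  ext x
  simp [lt_sub_iff_add_lt, ht.not_gt]

lemma integral_max_sub_zero_eq_setIntegral_measureReal_lt
    (hZ : Integrable (fun x => max (Z x - η) 0) P) :
    ∫ x, max (Z x - η) 0 ∂P = ∫ t in Set.Ioi η, P.real {x | t < Z x} := by
  have hshift := (measurePreserving_add_right volume η).setIntegral_preimage_emb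
    (measurableEmbedding_addRight η) (fun t => P.real {x | t < Z x}) (Set.Ioi η)
  rw [Set.preimage_add_const_Ioi, sub_self] at hshift
  rw [← hshift, hZ.integral_eq_integral_meas_lt (ae_of_all _ fun _ => le_max_right _ _)]
  exact setIntegral_congr_fun measurableSet_Ioi fun t ht =>
    congrArg P.real (setOf_lt_max_sub_zero Z η ht)

lemma antitone_measureReal_lt (P : Measure S) [IsFiniteMeasure P] (Z : S → ℝ) :
    Antitone fun t => P.real {x | t < Z x} :=
  fun _ _ hst => measureReal_mono fun _ hx => hst.trans_lt hx

lemma integrableOn_measureReal_lt [IsFiniteMeasure P]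
    (hZ : Integrable (fun x => max (Z x - η) 0) P) :
    IntegrableOn (fun t => P.real {x | t < Z x}) (Set.Ioi η) := by
  rw [← (measurePreserving_add_right volume η).integrableOn_comp_preimage
    (measurableEmbedding_addRight η), Set.preimage_add_const_Ioi, sub_self]
  refine ⟨((antitone_measureReal_lt P Z).measurable.comp
    (measurable_add_const η)).aestronglyMeasurable, ?_⟩
  have hfin : ∫⁻ t in Set.Ioi 0, P {x | t < max (Z x - η) 0} < ⊤ := by
    exact (lintegral_eq_lintegral_meas_lt P (ae_of_all _ fun _ => le_max_right _ _)
      hZ.aestronglyMeasurable.aemeasurable).symm.trans_lt hZ.lintegral_lt_top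
  refine (setLIntegral_congr_fun measurableSet_Ioi fun t ht => ?_).trans_lt hfin
  rw [setOf_lt_max_sub_zero Z η ht, Function.comp_apply, Real.enorm_of_nonneg measureReal_nonneg,
    ofReal_measureReal]

end Tail

section CVaR

variable {S : Type*} [MeasurableSpace S] {P : Measure S} {α : ℝ} {Z : S → ℝ} {a : ℝ}

lemma abs_iInf_sub_iInf_le {ι : Type*} [Nonempty ι] {f g : ι → ℝ} {K : ℝ}
    (hf : BddBelow (Set.range f)) (hg : BddBelow (Set.range g)) (h : ∀ i, |f i - g i| ≤ K) :
    |(⨅ i, f i) - ⨅ i, g i| ≤ K := by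
  have hfg : (⨅ i, f i) - K ≤ ⨅ i, g i := le_ciInf fun i => by
    linarith [ciInf_le hf i, (abs_le.1 (h i)).2]
  have hgf : (⨅ i, g i) - K ≤ ⨅ i, f i := le_ciInf fun i => by
    linarith [ciInf_le hg i, (abs_le.1 (h i)).1]
  exact abs_le.2 ⟨by linarith, by linarith⟩

/-- With `[Z - η]⁺ = ∫_η^∞ 1{t < Z} dt`, the objectives of two random variables differ by an
integral of the difference of their tail functions, whatever `η` is. -/
lemma abs_cvar_sub_cvar_le {T : Type*} [MeasurableSpace T] {Q : Measure T} [IsFiniteMeasure P]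
    [IsFiniteMeasure Q] {W : T → ℝ} (hα : 0 < α) (hZ : HasFiniteCVaR α P Z)
    (hW : HasFiniteCVaR α Q W)
    (hint : Integrable fun t => P.real {x | t < Z x} - Q.real {y | t < W y}) :
    |cvar α P Z - cvar α Q W| ≤
      α⁻¹ * ∫ t, |P.real {x | t < Z x} - Q.real {y | t < W y}| := by
  refine abs_iInf_sub_iInf_le hZ.2 hW.2 fun η => ?_
  rw [cvarObjective, cvarObjective, add_sub_add_left_eq_sub, ← mul_sub, abs_mul,
    abs_of_pos (inv_pos.2 hα), integral_max_sub_zero_eq_setIntegral_measureReal_lt (hZ.1 η),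
    integral_max_sub_zero_eq_setIntegral_measureReal_lt (hW.1 η),
    ← integral_sub (integrableOn_measureReal_lt (hZ.1 η)) (integrableOn_measureReal_lt (hW.1 η))]
  gcongr
  exact abs_integral_le_integral_abs.trans
    (setIntegral_le_integral hint.abs (ae_of_all _ fun _ => abs_nonneg _))

lemma le_cvarObjective [IsProbabilityMeasure P] (hα : α ∈ Set.Ioc (0 : ℝ) 1)
    (ha : ∀ᵐ x ∂P, a ≤ Z x) {η : ℝ} (hint : Integrable (fun x => max (Z x - η) 0) P) :
    a ≤ cvarObjective α P Z η := by
  have hexcess : max (a - η) 0 ≤ ∫ x, max (Z x - η) 0 ∂P := by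
    have hmono := integral_mono_ae (integrable_const (max (a - η) 0)) hint
      (ha.mono fun x hx => max_le_max_right 0 (sub_le_sub_right hx η))
    simpa using hmono
  have hscale : ∫ x, max (Z x - η) 0 ∂P ≤ α⁻¹ * ∫ x, max (Z x - η) 0 ∂P :=
    le_mul_of_one_le_left ((le_max_right _ _).trans hexcess) ((one_le_inv₀ hα.1).2 hα.2)
  rw [cvarObjective]
  linarith [le_max_left (a - η) 0]

lemma le_cvar [IsProbabilityMeasure P] (hα : α ∈ Set.Ioc (0 : ℝ) 1) (hZ : HasFiniteCVaR α P Z)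
    (ha : ∀ᵐ x ∂P, a ≤ Z x) : a ≤ cvar α P Z :=
  le_ciInf fun η => le_cvarObjective hα ha (hZ.1 η)

lemma cvar_le (hZ : HasFiniteCVaR α P Z) (ha : ∀ᵐ x ∂P, Z x ≤ a) : cvar α P Z ≤ a := by
  refine (ciInf_le hZ.2 a).trans_eq ?_
  have hzero : ∫ x, max (Z x - a) 0 ∂P = 0 := integral_eq_zero_of_ae <|
    ha.mono fun x hx => max_eq_right (sub_nonpos.2 hx)
  rw [cvarObjective, hzero, mul_zero, add_zero]

lemma hasFiniteCVaR_of_finite [Finite S] [MeasurableSingletonClass S] [IsProbabilityMeasure P]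
    (hα : α ∈ Set.Ioc (0 : ℝ) 1) (Z : S → ℝ) : HasFiniteCVaR α P Z := by
  obtain ⟨a, ha⟩ := (Set.finite_range Z).bddBelow
  exact ⟨fun _ => .of_finite, a, Set.forall_mem_range.2 fun _ =>
    le_cvarObjective hα (ae_of_all _ fun x => ha ⟨x, rfl⟩) .of_finite⟩

end CVaR

section EmpiricalCVaR

variable {α : ℝ} {N : ℕ}

lemma integral_uniformOn_univ (N : ℕ) (f : Fin N → ℝ) :
    ∫ j, f j ∂(uniformOn Set.univ) = (N : ℝ)⁻¹ * ∑ j, f j := by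
  simp [uniformOn, ProbabilityTheory.cond, integral_countable (.of_finite : Integrable f _),
    Finset.mul_sum]

lemma empCVaR_eq_cvar (α : ℝ) (z : Fin N → ℝ) : empCVaR α z = cvar α (uniformOn Set.univ) z := by
  simp only [empCVaR, cvar, cvarObjective, integral_uniformOn_univ, mul_inv_rev, mul_assoc]

lemma measureReal_uniformOn_univ_lt (z : Fin N → ℝ) (t : ℝ) :
    (uniformOn Set.univ : Measure (Fin N)).real {j | t < z j} =
      (N : ℝ)⁻¹ * ∑ j, (Set.Ioi t).indicator 1 (z j) := by
  rw [← integral_uniformOn_univ, ← integral_indicator_one (.of_discrete)]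
  rfl

lemma measurable_empCVaR (α : ℝ) (N : ℕ) : Measurable fun z : Fin N → ℝ => empCVaR α z := by
  have hrat (z : Fin N → ℝ) : empCVaR α z =
      ⨅ r : ℚ, ((r : ℝ) + ((N : ℝ) * α)⁻¹ * ∑ j, max (z j - r) 0) := by
    have hdense := Dense.ciInf' Rat.denseRange_cast
      (f := fun η : ℝ => η + ((N : ℝ) * α)⁻¹ * ∑ j, max (z j - η) 0) (by fun_prop)
    exact hdense.symm.trans (Set.rangeFactorization_surjective.iInf_comp _).symm
  simp_rw [hrat]
  exact .iInf fun r => by fun_prop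

end EmpiricalCVaR

section SampleMean

variable {S : Type*} [MeasurableSpace S] {P : Measure S} [IsProbabilityMeasure P] {N : ℕ}
  [NeZero N] {Y : S → ℝ}

lemma sq_integral_abs_sub_le_variance (hY : MemLp Y 2 P) :
    (∫ x, |Y x - ∫ y, Y y ∂P| ∂P) ^ 2 ≤ Var[Y; P] := by
  have hdev : MemLp (fun x => |Y x - ∫ y, Y y ∂P|) 2 P := (hY.sub (memLp_const _)).abs
  have hnonneg := variance_nonneg (fun x => |Y x - ∫ y, Y y ∂P|) P
  rw [variance_eq_sub hdev] at hnonneg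
  rw [variance_eq_integral hY.aemeasurable]
  simpa [sq_abs] using hnonneg

lemma integral_abs_sampleMean_sub_le (hY : MemLp Y 2 P) :
    ∫ x : Fin N → S, |(N : ℝ)⁻¹ * ∑ j, Y (x j) - ∫ y, Y y ∂P| ∂(Measure.pi fun _ => P) ≤
      √(Var[Y; P] / N) := by
  have hsum : MemLp (∑ j, fun x : Fin N → S => Y (x j)) 2 (Measure.pi fun _ => P) :=
    memLp_finsetSum' _ fun j _ => hY.comp_measurePreserving (measurePreserving_eval _ j)
  have hmean : ∫ x : Fin N → S, (N : ℝ)⁻¹ * (∑ j, fun x => Y (x j)) x ∂(Measure.pi fun _ => P) =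
      ∫ y, Y y ∂P := by
    simp only [Finset.sum_apply]
    rw [integral_const_mul, integral_finsetSum _ fun j _ =>
      integrable_comp_eval (μ := fun _ : Fin N => P) (hY.integrable one_le_two)]
    simp [integral_comp_eval (μ := fun _ : Fin N => P) hY.aestronglyMeasurable, NeZero.ne]
  have hvar : Var[fun x => (N : ℝ)⁻¹ * (∑ j, fun x : Fin N → S => Y (x j)) x;
      Measure.pi fun _ => P] = Var[Y; P] / N := by
    rw [variance_const_mul, variance_sum_pi (μ := fun _ : Fin N => P) fun _ => hY,
      Finset.sum_const, Finset.card_univ, Fintype.card_fin, nsmul_eq_mul]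
    field_simp
  have hle := sq_integral_abs_sub_le_variance (hsum.const_mul (N : ℝ)⁻¹)
  rw [hmean, hvar] at hle
  simpa using Real.le_sqrt_of_sq_le hle

end SampleMean

section TailDeviation

variable {S : Type*} [MeasurableSpace S] {P : Measure S} {Z : S → ℝ} {N : ℕ} {a b : ℝ}

/-- The deviation `P(Z > t) - N⁻¹ #{j | Z(xⱼ) > t}` of the empirical tail function of `Z`, formed
from a sample `x₁, …, x_N`, from its true tail function. -/
noncomputable def tailDeviation (P : Measure S) (Z : S → ℝ) (x : Fin N → S) (t : ℝ) : ℝ :=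
  P.real {y | t < Z y} - (uniformOn Set.univ).real {j | t < Z (x j)}

lemma measurable_tailDeviation [IsFiniteMeasure P] (hZ : Measurable Z) :
    Measurable fun p : (Fin N → S) × ℝ => tailDeviation P Z p.1 p.2 := by
  have hind (j : Fin N) :
      Measurable fun p : (Fin N → S) × ℝ => (Set.Ioi p.2).indicator (1 : ℝ → ℝ) (Z (p.1 j)) :=
    measurable_const.indicator (s := {p : (Fin N → S) × ℝ | p.2 < Z (p.1 j)})
      (measurableSet_lt measurable_snd (by fun_prop))
  simp only [tailDeviation, measureReal_uniformOn_univ_lt]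
  exact ((antitone_measureReal_lt P Z).measurable.comp measurable_snd).sub
    ((Finset.measurable_sum _ fun j _ => hind j).const_mul _)

lemma abs_tailDeviation_le_one [IsProbabilityMeasure P] (x : Fin N → S) (t : ℝ) :
    |tailDeviation P Z x t| ≤ 1 :=
  (abs_sub_le_of_nonneg_of_le measureReal_nonneg measureReal_le_one measureReal_nonneg
    measureReal_le_one)

lemma measureReal_lt_eq_ite [IsProbabilityMeasure P] {t : ℝ}
    (hZ : ∀ᵐ y ∂P, Z y ∈ Set.Icc a b) (ht : t ∉ Set.Icc a b) :
    P.real {y | t < Z y} = if t < a then 1 else 0 := by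
  split_ifs with hta
  · have huniv : {y | t < Z y} =ᵐ[P] Set.univ :=
      eventuallyEq_univ.2 (hZ.mono fun y hy => hta.trans_le hy.1)
    rw [measureReal_congr huniv, probReal_univ]
  · have hbt : b < t := not_le.1 fun htb => ht ⟨not_lt.1 hta, htb⟩
    have hempty : {y | t < Z y} =ᵐ[P] (∅ : Set S) :=
      eventuallyEq_empty.2 (hZ.mono fun y hy => (hy.2.trans_lt hbt).not_gt)
    rw [measureReal_congr hempty, measureReal_empty]

lemma tailDeviation_eq_zero [IsProbabilityMeasure P] [NeZero N] {x : Fin N → S} {t : ℝ}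
    (hZ : ∀ᵐ y ∂P, Z y ∈ Set.Icc a b) (hx : ∀ j, Z (x j) ∈ Set.Icc a b)
    (ht : t ∉ Set.Icc a b) : tailDeviation P Z x t = 0 := by
  rw [tailDeviation, measureReal_lt_eq_ite hZ ht, measureReal_lt_eq_ite (ae_of_all _ hx) ht,
    sub_self]

lemma integral_abs_tailDeviation_le [IsProbabilityMeasure P] [NeZero N] (hZ : Measurable Z)
    (t : ℝ) :
    ∫ x : Fin N → S, |tailDeviation P Z x t| ∂(Measure.pi fun _ => P) ≤ (2 * √N)⁻¹ := by
  set Y : S → ℝ := fun y => (Set.Ioi t).indicator 1 (Z y)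
  have hmem : ∀ᵐ y ∂P, Y y ∈ Set.Icc 0 1 := ae_of_all _ fun y =>
    ⟨Set.indicator_nonneg (fun _ _ => zero_le_one) _,
      Set.indicator_le_self' (fun _ _ => zero_le_one) _⟩
  have hYm : Measurable Y := (measurable_one.indicator measurableSet_Ioi).comp hZ
  have hmean : P.real {y | t < Z y} = ∫ y, Y y ∂P :=
    (integral_indicator_one (measurableSet_lt measurable_const hZ)).symm
  simp only [tailDeviation, measureReal_uniformOn_univ_lt, hmean, abs_sub_comm (∫ y, Y y ∂P)]
  refine (integral_abs_sampleMean_sub_le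
    (memLp_of_bounded hmem hYm.aestronglyMeasurable 2)).trans ?_
  have hvar := variance_le_sq_of_bounded hmem hYm.aemeasurable
  rw [Real.sqrt_le_left (by positivity), mul_inv, mul_pow, inv_pow (√(N : ℝ)),
    Real.sq_sqrt N.cast_nonneg, ← div_eq_mul_inv]
  gcongr
  simpa using hvar

lemma ae_pi_forall [IsProbabilityMeasure P] {p : S → Prop} (h : ∀ᵐ y ∂P, p y) :
    ∀ᵐ x : Fin N → S ∂(Measure.pi fun _ => P), ∀ j, p (x j) :=
  ae_all_iff.2 fun j =>
    (measurePreserving_eval (fun _ : Fin N => P) j).quasiMeasurePreserving.ae h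

lemma abs_empCVaR_sub_cvar_le [IsProbabilityMeasure P] [NeZero N] {α : ℝ}
    (hα : α ∈ Set.Ioc (0 : ℝ) 1) (hZ : Measurable Z) (hfin : HasFiniteCVaR α P Z)
    (hmem : ∀ᵐ y ∂P, Z y ∈ Set.Icc a b) {x : Fin N → S} (hx : ∀ j, Z (x j) ∈ Set.Icc a b) :
    |empCVaR α (fun j => Z (x j)) - cvar α P Z| ≤
      α⁻¹ * ∫ t in Set.Icc a b, |tailDeviation P Z x t| := by
  have hzero (t : ℝ) (ht : t ∉ Set.Icc a b) : tailDeviation P Z x t = 0 :=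
    tailDeviation_eq_zero hmem hx ht
  have hmeas : Measurable (tailDeviation P Z x) :=
    (measurable_tailDeviation hZ).comp measurable_prodMk_left
  have hint : Integrable (tailDeviation P Z x) := by
    refine (integrableOn_iff_integrable_of_support_subset
      (Function.support_subset_iff'.2 hzero)).1 ?_
    exact Integrable.of_bound hmeas.aestronglyMeasurable 1
      (ae_of_all _ fun t => abs_tailDeviation_le_one x t)
  rw [abs_sub_comm, empCVaR_eq_cvar, setIntegral_eq_integral_of_forall_compl_eq_zero
    fun t ht => by rw [hzero t ht, abs_zero]]
  exact abs_cvar_sub_cvar_le hα.1 hfin (hasFiniteCVaR_of_finite hα _) hint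

/-- The expectation is moved inside the integral over the level `t`, where the sample mean of an
indicator is within `1 / (2√N)` of its expectation. -/
theorem integral_abs_empCVaR_sub_cvar_le [IsProbabilityMeasure P] [NeZero N] {α : ℝ}
    (hα : α ∈ Set.Ioc (0 : ℝ) 1) (hZ : Measurable Z) (hfin : HasFiniteCVaR α P Z) (hab : a ≤ b)
    (hmem : ∀ᵐ y ∂P, Z y ∈ Set.Icc a b) :
    ∫ x : Fin N → S, |empCVaR α (fun j => Z (x j)) - cvar α P Z| ∂(Measure.pi fun _ => P) ≤
      α⁻¹ * ((b - a) / (2 * √N)) := by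
  have hint : Integrable (fun p : (Fin N → S) × ℝ => |tailDeviation P Z p.1 p.2|)
      ((Measure.pi fun _ => P).prod (volume.restrict (Set.Icc a b))) :=
    .of_bound (measurable_tailDeviation hZ).abs.aestronglyMeasurable 1
      (ae_of_all _ fun p => by simpa using abs_tailDeviation_le_one p.1 p.2)
  calc
    _ ≤ ∫ x : Fin N → S, α⁻¹ * (∫ t in Set.Icc a b, |tailDeviation P Z x t|)
          ∂(Measure.pi fun _ => P) :=
      integral_mono_of_nonneg (ae_of_all _ fun _ => abs_nonneg _)
        (hint.integral_prod_left.const_mul _)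
        ((ae_pi_forall hmem).mono fun x hx => abs_empCVaR_sub_cvar_le hα hZ hfin hmem hx)
    _ = α⁻¹ * ∫ t in Set.Icc a b, ∫ x : Fin N → S, |tailDeviation P Z x t|
          ∂(Measure.pi fun _ => P) := by
      rw [integral_const_mul, integral_integral_swap hint]
    _ ≤ α⁻¹ * ∫ _ in Set.Icc a b, (2 * √(N : ℝ))⁻¹ := by
      refine mul_le_mul_of_nonneg_left ?_ (inv_nonneg.2 hα.1.le)
      exact integral_mono hint.integral_prod_right (integrable_const _)
        fun t => integral_abs_tailDeviation_le hZ t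
    _ = α⁻¹ * ((b - a) / (2 * √N)) := by
      simp [hab, div_eq_mul_inv]

end TailDeviation

section Estimator

variable {n m : ℕ} {S : Type*} [MeasurableSpace S] {α : ℝ} {N : ℕ} [NeZero N] {a : ℝ}

lemma lt_empCVaR (hα : α ∈ Set.Ioc (0 : ℝ) 1) {z : Fin N → ℝ} (ha : ∀ j, a < z j) :
    a < empCVaR α z := by
  obtain ⟨j, hj⟩ := Finite.exists_min z
  rw [empCVaR_eq_cvar]
  exact (ha j).trans_le (le_cvar hα (hasFiniteCVaR_of_finite hα z) (ae_of_all _ hj))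

lemma empCVaR_lt (hα : α ∈ Set.Ioc (0 : ℝ) 1) {z : Fin N → ℝ} (ha : ∀ j, z j < a) :
    empCVaR α z < a := by
  obtain ⟨j, hj⟩ := Finite.exists_max z
  rw [empCVaR_eq_cvar]
  exact (cvar_le (hasFiniteCVaR_of_finite hα z) (ae_of_all _ hj)).trans_lt (ha j)

lemma ae_not_of_ae_pi_not_forall {N : ℕ} {P : Measure S} [SigmaFinite P] {p : S → Prop}
    (h : ∀ᵐ x : Fin N → S ∂(Measure.pi fun _ => P), ¬ ∀ j, p (x j)) : ∀ᵐ y ∂P, ¬ p y := by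
  have hpow : P {y | p y} ^ N = 0 := by
    have hpi : {x : Fin N → S | ∀ j, p (x j)} = Set.univ.pi fun _ => {y | p y} := by
      ext x
      simp
    rw [ae_iff] at h
    simp only [not_not] at h
    simpa [hpi, Measure.pi_pi] using h
  simpa [ae_iff] using eq_zero_of_pow_eq_zero hpow

/-- If the costs exceeded the bound with positive probability, so would, with positive probability,
all the `N` costs in a sample, and then also the empirical CVaR. -/
lemma ae_mem_Icc_of_ae_abs_empCVaR_sub_le {P : Measure S} [SigmaFinite P] {Z : S → ℝ} {c B : ℝ}
    (hα : α ∈ Set.Ioc (0 : ℝ) 1)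
    (hB : ∀ᵐ x : Fin N → S ∂(Measure.pi fun _ => P), |empCVaR α (fun j => Z (x j)) - c| ≤ B) :
    ∀ᵐ y ∂P, Z y ∈ Set.Icc (c - B) (c + B) := by
  have hupper : ∀ᵐ y ∂P, ¬ c + B < Z y := by
    refine ae_not_of_ae_pi_not_forall (N := N) ?_
    filter_upwards [hB] with x hx hlt
    linarith [lt_empCVaR hα hlt, (abs_le.1 hx).2]
  have hlower : ∀ᵐ y ∂P, ¬ Z y < c - B := by
    refine ae_not_of_ae_pi_not_forall (N := N) ?_
    filter_upwards [hB] with x hx hlt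
    linarith [empCVaR_lt hα hlt, (abs_le.1 hx).1]
  filter_upwards [hupper, hlower] with y hyu hyl
  exact ⟨not_lt.1 hyl, not_lt.1 hyu⟩

lemma measurable_empMap {T : Type*} [MeasurableSpace T] {N : ℕ} {C : E n → E m → E n}
    (hC : Measurable fun p : E n × E m => C p.1 p.2) {h : T → E n} {x : T → Fin N → E m}
    (hh : Measurable h) (hx : Measurable x) : Measurable fun t => empMap α C (x t) (h t) := by
  refine (WithLp.measurable_toLp 2 _).comp (measurable_pi_lambda _ fun i => ?_)
  refine (measurable_empCVaR α N).comp (measurable_pi_lambda _ fun j => ?_)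
  exact (EuclideanSpace.proj (𝕜 := ℝ) i).measurable.comp
    (hC.comp (hh.prodMk ((measurable_pi_apply j).comp hx)))

lemma norm_le_sum_abs (v : E n) : ‖v‖ ≤ ∑ i, |v i| := by
  rw [EuclideanSpace.norm_eq]
  exact Real.sqrt_le_iff.2 ⟨Finset.sum_nonneg fun _ _ => abs_nonneg _,
    Finset.sum_sq_le_sq_sum_of_nonneg fun _ _ => abs_nonneg _⟩

theorem integral_norm_empMap_sub_cvarMap_le {P : Measure (E m)} [IsProbabilityMeasure P]
    {C : E n → E m → E n} {h : E n} {B : ℝ} (hα : α ∈ Set.Ioc (0 : ℝ) 1) (hC : Measurable (C h))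
    (hfin : ∀ i, HasFiniteCVaR α P fun y => C h y i)
    (hB : ∀ᵐ x : Fin N → E m ∂(Measure.pi fun _ => P), ‖empMap α C x h - cvarMap α P C h‖ ≤ B) :
    ∫ x : Fin N → E m, ‖empMap α C x h - cvarMap α P C h‖ ∂(Measure.pi fun _ => P) ≤
      n * (α⁻¹ * (B / √N)) := by
  obtain ⟨_, hB0⟩ := (hB.mono fun _ hx => (norm_nonneg _).trans hx).exists
  have hCi (i : Fin n) : Measurable fun y => C h y i :=
    (EuclideanSpace.proj (𝕜 := ℝ) i).measurable.comp hC
  have hBi (i : Fin n) : ∀ᵐ x : Fin N → E m ∂(Measure.pi fun _ => P),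
      |empCVaR α (fun j => C h (x j) i) - cvar α P fun y => C h y i| ≤ B :=
    hB.mono fun x hx => (PiLp.norm_apply_le (empMap α C x h - cvarMap α P C h) i).trans hx
  have hint (i : Fin n) : Integrable (fun x : Fin N → E m =>
      |empCVaR α (fun j => C h (x j) i) - cvar α P fun y => C h y i|)
      (Measure.pi fun _ => P) := by
    have hemp : Measurable fun x : Fin N → E m => empCVaR α fun j => C h (x j) i :=
      (measurable_empCVaR α N).comp (measurable_pi_lambda _ fun j =>
        (hCi i).comp (measurable_pi_apply j))
    exact .of_bound (hemp.sub_const _).abs.aestronglyMeasurable B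
      ((hBi i).mono fun x hx => by rwa [Real.norm_eq_abs, abs_abs])
  calc
    _ ≤ ∫ x : Fin N → E m, ∑ i, |empCVaR α (fun j => C h (x j) i) - cvar α P fun y => C h y i|
          ∂(Measure.pi fun _ => P) :=
      integral_mono_of_nonneg (ae_of_all _ fun _ => norm_nonneg _)
        (integrable_finsetSum _ fun i _ => hint i) (ae_of_all _ fun _ => norm_le_sum_abs _)
    _ ≤ ∑ _ : Fin n, α⁻¹ * (B / √N) := by
      rw [integral_finsetSum _ fun i _ => hint i]
      refine Finset.sum_le_sum fun i _ => (integral_abs_empCVaR_sub_cvar_le hα (hCi i) (hfin i)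
        (by linarith) (ae_mem_Icc_of_ae_abs_empCVaR_sub_le hα (hBi i))).trans_eq ?_
      field_simp
      ring
    _ = n * (α⁻¹ * (B / √N)) := by simp

end Estimator

section Samples

variable {m : ℕ} {Ω : Type*} {mΩ : MeasurableSpace Ω} {μ : Measure Ω} {N : ℕ → ℕ}

/-- The information available before iteration `k`: the samples drawn at earlier iterations. -/
def sampleFiltration (ξ : (k : ℕ) → Fin (N k) → Ω → E m) (hξ : ∀ k j, Measurable (ξ k j)) :
    Filtration ℕ mΩ where
  seq k := ⨆ i ∈ {i : Σ k, Fin (N k) | i.1 < k}, MeasurableSpace.comap (ξ i.1 i.2) inferInstance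
  mono' _ _ hkl := biSup_mono fun _ hi => lt_of_lt_of_le hi hkl
  le' _ := iSup₂_le fun i _ => (hξ i.1 i.2).comap_le

variable {ξ : (k : ℕ) → Fin (N k) → Ω → E m}

lemma measurable_sample_succ (hξ : ∀ k j, Measurable (ξ k j)) (k : ℕ) :
    Measurable[sampleFiltration ξ hξ (k + 1)] fun ω j => ξ k j ω := by
  refine @measurable_pi_lambda _ _ _ (sampleFiltration ξ hξ (k + 1)) _ _ fun j => ?_
  refine Measurable.of_comap_le ?_
  exact le_iSup₂_of_le (⟨k, j⟩ : Σ k, Fin (N k)) (Nat.lt_succ_self k) le_rfl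

lemma indep_sampleFiltration (hξ : ∀ k j, Measurable (ξ k j))
    (hind : iIndepFun (fun i : (Σ k, Fin (N k)) => ξ i.1 i.2) μ) (k : ℕ) :
    Indep (sampleFiltration ξ hξ k)
      (MeasurableSpace.comap (fun ω j => ξ k j ω) inferInstance) μ := by
  have hpast := indep_iSup_of_disjoint (fun i : (Σ k, Fin (N k)) => (hξ i.1 i.2).comap_le) hind
    (S := {i | i.1 < k}) (T := {i | i.1 = k})
    (Set.disjoint_left.2 fun i hi hi' => (Set.mem_ofPred.1 hi).ne hi')
  refine indep_of_indep_of_le_right hpast (Measurable.comap_le ?_)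
  refine @measurable_pi_lambda _ _ _ (_) _ _ fun j => Measurable.of_comap_le ?_
  exact le_iSup₂_of_le (⟨k, j⟩ : Σ k, Fin (N k)) rfl le_rfl

lemma map_sample_eq_pi {P : Measure (E m)}
    (hξ : ∀ k j, Measurable (ξ k j)) (hlaw : ∀ k j, μ.map (ξ k j) = P)
    (hind : iIndepFun (fun i : (Σ k, Fin (N k)) => ξ i.1 i.2) μ) (k : ℕ) :
    μ.map (fun ω j => ξ k j ω) = Measure.pi fun _ => P := by
  have := hind.isProbabilityMeasure
  have hindk := hind.precomp (g := fun j : Fin (N k) => (⟨k, j⟩ : Σ k, Fin (N k)))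
    fun _ _ hab => by simpa using hab
  rw [(iIndepFun_iff_map_fun_eq_pi_map fun j => (hξ k j).aemeasurable).1 hindk]
  simp_rw [hlaw]

end Samples

section Drift

variable {n m : ℕ} {α : ℝ} {P : Measure (E m)} [IsProbabilityMeasure P] {C : E n → E m → E n}
  {h x : E n} {N : ℕ} [NeZero N] {B c D : ℝ}

lemma le_integral_inner_empMap (hα : α ∈ Set.Ioc (0 : ℝ) 1)
    (hC : Measurable fun p : E n × E m => C p.1 p.2)
    (hfin : ∀ i, HasFiniteCVaR α P fun y => C h y i)
    (hB : ∀ᵐ y : Fin N → E m ∂(Measure.pi fun _ => P), ‖empMap α C y h - cvarMap α P C h‖ ≤ B)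
    (hgap : c ≤ inner ℝ (cvarMap α P C h) (h - x)) (hD : ‖h - x‖ ≤ D) :
    c - D * (n * (α⁻¹ * (B / √N))) ≤
      ∫ y : Fin N → E m, inner ℝ (empMap α C y h) (h - x) ∂(Measure.pi fun _ => P) := by
  have hemp : Measurable fun y : Fin N → E m => empMap α C y h :=
    measurable_empMap hC measurable_const measurable_id
  have herr : Integrable (fun y : Fin N → E m => empMap α C y h - cvarMap α P C h)
      (Measure.pi fun _ => P) := .of_bound (hemp.sub_const _).aestronglyMeasurable B hB
  have hinner : Integrable (fun y : Fin N → E m => inner ℝ (empMap α C y h) (h - x))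
      (Measure.pi fun _ => P) := by
    simpa using (herr.add (integrable_const (cvarMap α P C h))).inner_const (h - x)
  have hmean := integral_norm_empMap_sub_cvarMap_le hα (hC.comp measurable_prodMk_left) hfin hB
  have hbound : Integrable (fun y : Fin N → E m =>
      c - D * ‖empMap α C y h - cvarMap α P C h‖) (Measure.pi fun _ => P) :=
    (integrable_const c).sub (herr.norm.const_mul D)
  calc
    _ ≤ c - D * ∫ y : Fin N → E m, ‖empMap α C y h - cvarMap α P C h‖
          ∂(Measure.pi fun _ => P) := by
      have hD0 : 0 ≤ D := (norm_nonneg _).trans hD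
      gcongr
    _ = ∫ y : Fin N → E m, (c - D * ‖empMap α C y h - cvarMap α P C h‖)
          ∂(Measure.pi fun _ => P) := by
      rw [integral_sub (integrable_const c) (herr.norm.const_mul D), integral_const_mul]
      simp
    _ ≤ _ := by
      refine integral_mono hbound hinner fun y => ?_
      have herror := (abs_le.1 (abs_real_inner_le_norm
        (empMap α C y h - cvarMap α P C h) (h - x))).1
      rw [inner_sub_left] at herror
      nlinarith [norm_nonneg (empMap α C y h - cvarMap α P C h)]

end Drift

section Algorithm

variable {n m : ℕ} {Ω : Type*} {mΩ : MeasurableSpace Ω} {μ : Measure Ω} {N : ℕ → ℕ}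
  {ξ : (k : ℕ) → Fin (N k) → Ω → E m} {α : ℝ} {P : Measure (E m)} {C : E n → E m → E n}
  {H : Set (E n)} {γ : ℕ → ℝ} {h₀ x : E n} {B c D M ρ ε : ℝ}

lemma iterates_mem (hclosed : IsClosed H) (hh₀ : h₀ ∈ H) (k : ℕ) (ω : Ω) :
    iterates α C H γ N ξ h₀ k ω ∈ H := by
  cases k with
  | zero => exact hh₀
  | succ k => exact proj_mem hclosed ⟨h₀, hh₀⟩ _

lemma measurable_empMap_sample (hC : Measurable fun p : E n × E m => C p.1 p.2)
    (hξ : ∀ k j, Measurable (ξ k j)) {k : ℕ} {h : Ω → E n}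
    (hh : Measurable[sampleFiltration ξ hξ k] h) :
    Measurable[sampleFiltration ξ hξ (k + 1)] fun ω => empMap α C (fun j => ξ k j ω) (h ω) :=
  @measurable_empMap _ _ _ _ (_) _ _ hC _ _
    (hh.mono ((sampleFiltration ξ hξ).mono k.le_succ) le_rfl) (measurable_sample_succ hξ k)

lemma measurable_iterates (hC : Measurable fun p : E n × E m => C p.1 p.2) (hconv : Convex ℝ H)
    (hclosed : IsClosed H) (hne : H.Nonempty) (hξ : ∀ k j, Measurable (ξ k j)) (k : ℕ) :
    Measurable[sampleFiltration ξ hξ k] (iterates α C H γ N ξ h₀ k) := by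
  induction k with
  | zero => exact @measurable_const _ _ _ (_) _
  | succ k ih =>
    exact (continuous_proj hconv hclosed hne).measurable.comp
      ((ih.mono ((sampleFiltration ξ hξ).mono k.le_succ) le_rfl).sub
        (Measurable.fun_const_smul (measurable_empMap_sample hC hξ ih) (γ k)))

/-- Given the past, `ξ k` is a fresh sample from `P`, so the bound on the error at the random point
`h^k` holds at almost every value of `h^k` taken as a fixed point. -/
lemma ae_ae_pi_norm_empMap_sub_cvarMap_le (hC : Measurable fun p : E n × E m => C p.1 p.2)
    (hconv : Convex ℝ H) (hclosed : IsClosed H) (hFcont : ContinuousOn (cvarMap α P C) H)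
    (hξ : ∀ k j, Measurable (ξ k j)) (hlaw : ∀ k j, μ.map (ξ k j) = P)
    (hind : iIndepFun (fun i : (Σ k, Fin (N k)) => ξ i.1 i.2) μ) (hh₀ : h₀ ∈ H) (k : ℕ)
    (hB : ∀ᵐ ω ∂μ, ‖estError α P C H γ N ξ h₀ k ω‖ ≤ B) :
    ∀ᵐ ω ∂μ, ∀ᵐ y : Fin (N k) → E m ∂(Measure.pi fun _ => P),
      ‖empMap α C y (iterates α C H γ N ξ h₀ k ω) -
        cvarMap α P C (iterates α C H γ N ξ h₀ k ω)‖ ≤ B := by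
  have := hind.isProbabilityMeasure
  have hFproj : Continuous fun h => cvarMap α P C (proj H h) :=
    hFcont.comp_continuous (continuous_proj hconv hclosed ⟨h₀, hh₀⟩)
      (proj_mem hclosed ⟨h₀, hh₀⟩)
  have hevent : MeasurableSet {p : E n × (Fin (N k) → E m) |
      ‖empMap α C p.2 p.1 - cvarMap α P C (proj H p.1)‖ ≤ B} :=
    measurableSet_le ((measurable_empMap hC measurable_fst measurable_snd).sub
      (hFproj.measurable.comp measurable_fst)).norm measurable_const
  have hproj (ω : Ω) : proj H (iterates α C H γ N ξ h₀ k ω) = iterates α C H γ N ξ h₀ k ω :=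
    proj_eq_self hclosed (iterates_mem hclosed hh₀ k ω)
  have hmeas := measurable_iterates (α := α) (γ := γ) (h₀ := h₀) hC hconv hclosed ⟨h₀, hh₀⟩ hξ k
  have hindk : IndepFun (iterates α C H γ N ξ h₀ k) (fun ω j => ξ k j ω) μ :=
    (IndepFun_iff_Indep _ _ _).2
      (indep_of_indep_of_le_left (indep_sampleFiltration hξ hind k) hmeas.comap_le)
  have hae := ae_ae_map_of_indepFun (hmeas.mono ((sampleFiltration ξ hξ).le k) le_rfl)
    (measurable_pi_lambda _ fun j => hξ k j) hindk hevent
    (by simpa only [hproj, estError] using hB)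
  rw [map_sample_eq_pi hξ hlaw hind] at hae
  simpa only [hproj] using hae

lemma ae_le_condExp_inner_empMap (hα : α ∈ Set.Ioc (0 : ℝ) 1) [IsProbabilityMeasure P]
    (hC : Measurable fun p : E n × E m => C p.1 p.2) (hconv : Convex ℝ H) (hcomp : IsCompact H)
    (hfin : ∀ h ∈ H, ∀ i, HasFiniteCVaR α P fun y => C h y i)
    (hFcont : ContinuousOn (cvarMap α P C) H) (hD : ∀ h ∈ H, ‖h - x‖ ≤ D)
    (hgap : ∀ h ∈ H, ρ ≤ ‖h - x‖ → c ≤ inner ℝ (cvarMap α P C h) (h - x))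
    (hξ : ∀ k j, Measurable (ξ k j)) (hlaw : ∀ k j, μ.map (ξ k j) = P)
    (hind : iIndepFun (fun i : (Σ k, Fin (N k)) => ξ i.1 i.2) μ) (hh₀ : h₀ ∈ H) (k : ℕ)
    [NeZero (N k)] (hB : ∀ᵐ ω ∂μ, ‖estError α P C H γ N ξ h₀ k ω‖ ≤ B)
    (hM : ∀ᵐ ω ∂μ, ‖empMap α C (fun j => ξ k j ω) (iterates α C H γ N ξ h₀ k ω)‖ ≤ M) :
    ∀ᵐ ω ∂μ, ρ ≤ ‖iterates α C H γ N ξ h₀ k ω - x‖ →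
      c - D * (n * (α⁻¹ * (B / √(N k)))) ≤
        (μ[fun ω => inner ℝ (empMap α C (fun j => ξ k j ω) (iterates α C H γ N ξ h₀ k ω))
          (iterates α C H γ N ξ h₀ k ω - x) | sampleFiltration ξ hξ k]) ω := by
  have := hind.isProbabilityMeasure
  have hmem := iterates_mem (α := α) (C := C) (γ := γ) (ξ := ξ) hcomp.isClosed hh₀ k
  have hmeas := measurable_iterates (α := α) (γ := γ) (h₀ := h₀) hC hconv hcomp.isClosed
    ⟨h₀, hh₀⟩ hξ k
  have hsample : Measurable fun ω j => ξ k j ω := measurable_pi_lambda _ fun j => hξ k j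
  have hf : Measurable fun p : E n × (Fin (N k) → E m) => inner ℝ (empMap α C p.2 p.1) (p.1 - x) :=
    (measurable_empMap hC measurable_fst measurable_snd).inner (measurable_fst.sub_const x)
  have hint : Integrable (fun ω => inner ℝ (empMap α C (fun j => ξ k j ω)
      (iterates α C H γ N ξ h₀ k ω)) (iterates α C H γ N ξ h₀ k ω - x)) μ := by
    refine .of_bound (hf.comp ((hmeas.mono ((sampleFiltration ξ hξ).le k) le_rfl).prodMk
      hsample)).aestronglyMeasurable (M * D) (hM.mono fun ω hω => ?_)
    exact (norm_inner_le_norm _ _).trans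
      (mul_le_mul hω (hD _ (hmem ω)) (norm_nonneg _) ((norm_nonneg _).trans hω))
  have hcond := condExp_prod_ae_eq_integral_map_of_indep ((sampleFiltration ξ hξ).le k) hmeas
    hsample (indep_sampleFiltration hξ hind k) hf hint
  rw [map_sample_eq_pi hξ hlaw hind] at hcond
  filter_upwards [hcond, ae_ae_pi_norm_empMap_sub_cvarMap_le hC hconv hcomp.isClosed hFcont hξ hlaw
    hind hh₀ k hB] with ω hω hBω hρω
  rw [hω]
  exact le_integral_inner_empMap hα hC (hfin _ (hmem ω)) hBω (hgap _ (hmem ω) hρω) (hD _ (hmem ω))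

theorem ae_eventually_norm_iterates_sub_le (hα : α ∈ Set.Ioc (0 : ℝ) 1) [IsProbabilityMeasure P]
    (hC : Measurable fun p : E n × E m => C p.1 p.2) (hconv : Convex ℝ H) (hcomp : IsCompact H)
    (hfin : ∀ h ∈ H, ∀ i, HasFiniteCVaR α P fun y => C h y i)
    (hFcont : ContinuousOn (cvarMap α P C) H) (hx : x ∈ H) (hD : ∀ h ∈ H, ‖h - x‖ ≤ D)
    (hc : 0 < c) (hgap : ∀ h ∈ H, ρ ≤ ‖h - x‖ → c ≤ inner ℝ (cvarMap α P C h) (h - x))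
    (hρ : 0 ≤ ρ) (hρε : ρ < ε) (hγ0 : ∀ k, 0 ≤ γ k)
    (hγ : Tendsto (fun K => ∑ k ∈ Finset.range K, γ k) atTop atTop)
    (hγ2 : Summable fun k => γ k ^ 2) (hξ : ∀ k j, Measurable (ξ k j))
    (hlaw : ∀ k j, μ.map (ξ k j) = P)
    (hind : iIndepFun (fun i : (Σ k, Fin (N k)) => ξ i.1 i.2) μ) (hh₀ : h₀ ∈ H)
    (hB : ∀ᵐ ω ∂μ, ∀ k, ‖estError α P C H γ N ξ h₀ k ω‖ ≤ B)
    (hN : ∀ k, 0 < N k ∧ D * (n * (α⁻¹ * (B / √(N k)))) ≤ c / 2) :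
    ∀ᵐ ω ∂μ, ∀ᶠ k in atTop, ‖iterates α C H γ N ξ h₀ k ω - x‖ ≤ ε := by
  have := hind.isProbabilityMeasure
  obtain ⟨G, hG⟩ := hcomp.exists_bound_of_continuousOn hFcont
  have hmem := iterates_mem (α := α) (C := C) (γ := γ) (ξ := ξ) hcomp.isClosed hh₀
  have hmeas := measurable_iterates (α := α) (γ := γ) (h₀ := h₀) hC hconv hcomp.isClosed
    ⟨h₀, hh₀⟩ hξ
  have hM : ∀ᵐ ω ∂μ, ∀ k, ‖empMap α C (fun j => ξ k j ω) (iterates α C H γ N ξ h₀ k ω)‖ ≤ B + G :=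
    hB.mono fun ω hω k => by
      simpa only [estError, sub_add_cancel] using norm_add_le_of_le (hω k) (hG _ (hmem k ω))
  refine ae_eventually_norm_sub_le_of_le_condExp hconv hcomp hx hmeas
    (fun k => measurable_empMap_sample hC hξ (hmeas k)) hmem (fun _ _ => rfl) hM hγ0 hγ hγ2
    (half_pos hc) (fun k => ?_) hρ hρε
  have : NeZero (N k) := ⟨(hN k).1.ne'⟩
  filter_upwards [ae_le_condExp_inner_empMap hα hC hconv hcomp hfin hFcont hD hgap hξ hlaw hind hh₀
    k (ae_all_iff.1 hB k) (ae_all_iff.1 hM k)] with ω hω hρω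
  linarith [hω hρω, (hN k).2]

end Algorithm

lemma exists_forall_ge_div_sqrt_le (a : ℝ) {δ : ℝ} (hδ : 0 < δ) :
    ∃ N₀ : ℕ, ∀ N ≥ N₀, 0 < N ∧ a / √(N : ℝ) ≤ δ := by
  have hlim : Tendsto (fun N : ℕ => a / √(N : ℝ)) atTop (𝓝 0) :=
    tendsto_const_nhds.div_atTop (Real.tendsto_sqrt_atTop.comp tendsto_natCast_atTop_atTop)
  exact eventually_atTop.1 ((eventually_gt_atTop 0).and (hlim.eventually_le_const hδ))

end CVaRVI

open CVaRVI in
theorem proposition1_general {n m : ℕ} {α : ℝ} (hα : α ∈ Set.Ioc (0 : ℝ) 1) (P : Measure (E m))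
    [IsProbabilityMeasure P] (C : E n → E m → E n)
    (hC : Measurable fun p : E n × E m => C p.1 p.2) {H : Set (E n)} (hne : H.Nonempty)
    (hconv : Convex ℝ H) (hcomp : IsCompact H)
    (hfin : ∀ h ∈ H, ∀ i, HasFiniteCVaR α P fun x => C h x i)
    (hFmono : StrictlyMonotoneOn (cvarMap α P C) H) (hFcont : ContinuousOn (cvarMap α P C) H) :
    ∃ hstar : E n, viSol H (cvarMap α P C) = {hstar} ∧
      ∀ B : ℝ, ∀ ε : ℝ, 0 < ε → ∃ Nε : ℕ,
        ∀ (γ : ℕ → ℝ), (∀ k, 0 < γ k) →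
          Tendsto (fun K => ∑ k ∈ Finset.range K, γ k) atTop atTop →
          Summable (fun k => γ k ^ 2) →
        ∀ h₀ ∈ H, ∀ N : ℕ → ℕ,
        ∀ (Ω : Type*) [MeasurableSpace Ω] (μ : Measure Ω) [IsProbabilityMeasure μ]
          (ξ : (k : ℕ) → Fin (N k) → Ω → E m),
          (∀ k j, Measurable (ξ k j)) →
          (∀ k j, μ.map (ξ k j) = P) →
          iIndepFun (fun i : (Σ k, Fin (N k)) => ξ i.1 i.2) μ →
          (∀ᵐ ω ∂μ, ∀ k, ‖estError α P C H γ N ξ h₀ k ω‖ ≤ B) →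
          (∀ k, Nε ≤ N k) →
          ∀ᵐ ω ∂μ, limsup (fun k => ‖iterates α C H γ N ξ h₀ k ω - hstar‖) atTop ≤ ε := by
  obtain ⟨hstar, hsol⟩ := hFmono.exists_viSol_eq_singleton hFcont hconv hcomp hne
  have hmem : hstar ∈ viSol H (cvarMap α P C) := hsol ▸ Set.mem_singleton hstar
  refine ⟨hstar, hsol, fun B ε hε => ?_⟩
  obtain ⟨c, hc, hgap⟩ := hFmono.exists_pos_le_inner hFcont hcomp hmem (half_pos hε)
  have hD (h) (hh : h ∈ H) : ‖h - hstar‖ ≤ Metric.diam H :=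
    dist_eq_norm h hstar ▸ Metric.dist_le_diam_of_mem hcomp.isBounded hh hmem.1
  obtain ⟨Nε, hNε⟩ :=
    exists_forall_ge_div_sqrt_le (Metric.diam H * (n * (α⁻¹ * B))) (half_pos hc)
  refine ⟨Nε, fun γ hγ0 hγ hγ2 h₀ hh₀ N Ω _ μ _ ξ hξ hlaw hind hB hN => ?_⟩
  filter_upwards [ae_eventually_norm_iterates_sub_le hα hC hconv hcomp hfin hFcont hmem.1 hD hc hgap
    (half_pos hε).le (half_lt_self hε) (fun k => (hγ0 k).le) hγ hγ2 hξ hlaw hind hh₀ hB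
    (fun k => by simpa only [mul_div_assoc] using hNε (N k) (hN k))] with ω hω
  exact limsup_le_of_le (isCoboundedUnder_le_of_le atTop fun k => norm_nonneg _) hω

theorem proposition1 {n m l s : ℕ}
    (α : ℝ) (hα : α ∈ Set.Ioc (0 : ℝ) 1)
    (P : Measure (CVaRVI.E m)) [IsProbabilityMeasure P]
    (C : CVaRVI.E n → CVaRVI.E m → CVaRVI.E n)
    (hC : Measurable fun p : CVaRVI.E n × CVaRVI.E m => C p.1 p.2)
    (hfin : ∀ h i, CVaRVI.HasFiniteCVaR α P fun x => C h x i)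
    (hFmono : CVaRVI.StrictlyMonotone (CVaRVI.cvarMap α P C))
    (hFcont : Continuous (CVaRVI.cvarMap α P C))
    (A : Matrix (Fin l) (Fin n) ℝ) (b : Fin l → ℝ) (q : Fin s → CVaRVI.E n → ℝ)
    (hqconv : ∀ i, ConvexOn ℝ Set.univ (q i)) (hqdiff : ∀ i, ContDiff ℝ 1 (q i))
    (H : Set (CVaRVI.E n)) (hH : H = CVaRVI.feasibleSet A b q)
    (hHne : H.Nonempty) (hHcomp : IsCompact H) :
    ∃ hstar : CVaRVI.E n, CVaRVI.viSol H (CVaRVI.cvarMap α P C) = {hstar} ∧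
      ∀ B : ℝ, ∀ ε : ℝ, 0 < ε → ∃ Nε : ℕ,
        ∀ (γ : ℕ → ℝ), (∀ k, 0 < γ k) →
          Tendsto (fun K => ∑ k ∈ Finset.range K, γ k) atTop atTop →
          Summable (fun k => γ k ^ 2) →
        ∀ h₀ ∈ H, ∀ N : ℕ → ℕ,
        ∀ (Ω : Type*) [MeasurableSpace Ω] (μ : Measure Ω) [IsProbabilityMeasure μ]
          (ξ : (k : ℕ) → Fin (N k) → Ω → CVaRVI.E m),
          (∀ k j, Measurable (ξ k j)) →
          (∀ k j, μ.map (ξ k j) = P) →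
          iIndepFun (fun i : (Σ k, Fin (N k)) => ξ i.1 i.2) μ →
          (∀ᵐ ω ∂μ, ∀ k, ‖CVaRVI.estError α P C H γ N ξ h₀ k ω‖ ≤ B) →
          (∀ k, Nε ≤ N k) →
          ∀ᵐ ω ∂μ,
            limsup (fun k => ‖CVaRVI.iterates α C H γ N ξ h₀ k ω - hstar‖) atTop ≤ ε := by
  subst hH
  exact proposition1_general hα P C hC hHne (CVaRVI.convex_feasibleSet A b hqconv) hHcomp
    (fun h _ => hfin h) (hFmono.strictlyMonotoneOn _) hFcont.continuousOn
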